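/- Let $d\ge 2$. For $\lambda\in(0,1)$ let $L=\lceil\lambda^{-100}\rceil$, let $\mathbb Z^d_L=\mathbb Z^d/L\mathbb Z^d$, let $\Delta_L$ be the nearest-neighbour Laplacian on $\ell^2(\mathbb Z^d_L)$, $(\Delta_L\psi)(x)=\sum_{i=1}^d(\psi(x+e_i)+\psi(x-e_i))$, let $V$ be multiplication by a random potential $(V_x)_{x\in\mathbb Z^d_L}$ whose values are independent standard Gaussians, and let $H=\Delta_L+\lambda V$. Then there is a constant $c=c(d)>0$ such that for every $K_0>0$ there is $\lambda_0=\lambda_0(d,K_0)>0$ with the following property: for all $0<\lambda\le\lambda_0$ and all $K\ge K_0$, with probability at least $1-\exp(-cK^2)$ the estimate \[ \|e^{-itH}-e^{-it\Delta_L}\|_{\ell^2\to\ell^2}\le K(\log\lambda^{-1})^2\,\lambda\,\sqrt{|t|} \] holds simultaneously for all $t\in\mathbb R$. -/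

import Mathlib

noncomputable section

namespace Anderson

/-- The discrete torus `(ℤ / Lℤ)^d`. -/
abbrev Torus (d L : ℕ) : Type := Fin d → ZMod L

/-- The Hilbert space `ℓ²` of complex functions on the torus. -/
abbrev L2 (d L : ℕ) [NeZero L] : Type := EuclideanSpace ℂ (Torus d L)

/-- The matrix of the nearest-neighbour Laplacian on the torus, normalised without diagonal term
(so that its spectrum lies in `[-2d, 2d]`):
`(Δ ψ)(x) = ∑ i, (ψ (x + e_i) + ψ (x - e_i))`. -/
def laplacianMatrix (d L : ℕ) [NeZero L] : Matrix (Torus d L) (Torus d L) ℂ :=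
  Matrix.of fun x y =>
    ∑ i : Fin d, ((if y = x + Pi.single i 1 then 1 else 0)
      + (if y = x - Pi.single i 1 then 1 else 0))

/-- The Laplacian as an operator on `ℓ²` of the torus. -/
def laplacian (d L : ℕ) [NeZero L] : L2 d L →L[ℂ] L2 d L :=
  Matrix.toEuclideanCLM (𝕜 := ℂ) (laplacianMatrix d L)

/-- Multiplication by the real potential `V` on `ℓ²` of the torus. -/
def potentialOp {d L : ℕ} [NeZero L] (V : Torus d L → ℝ) : L2 d L →L[ℂ] L2 d L :=
  Matrix.toEuclideanCLM (𝕜 := ℂ) (Matrix.diagonal fun x => (V x : ℂ))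

/-- The Anderson Hamiltonian `H = Δ + lam V`. -/
def hamiltonian {d L : ℕ} [NeZero L] (lam : ℝ) (V : Torus d L → ℝ) : L2 d L →L[ℂ] L2 d L :=
  laplacian d L + (lam : ℂ) • potentialOp V

/-- The propagator `e^{-itA}` of a bounded operator `A`. -/
def propagator {d L : ℕ} [NeZero L] (A : L2 d L →L[ℂ] L2 d L) (t : ℝ) : L2 d L →L[ℂ] L2 d L :=
  NormedSpace.exp ((-(Complex.I * (t : ℂ))) • A)

/-- The law of the random potential: the values `V x` are independent standard Gaussians. -/
def potentialLaw (d L : ℕ) [NeZero L] : MeasureTheory.Measure (Torus d L → ℝ) :=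
  MeasureTheory.Measure.pi fun _ => ProbabilityTheory.gaussianReal 0 1

end Anderson

end

/-!
The proof controls the whole Dyson series by its first-order term at dyadic times.

Write `D` for the Laplacian, `W` for the perturbation `lam V`, and `U t = e^{itD} e^{-it(D + W)}`
for the propagator in the interaction picture (`interaction`), whose first-order term is `-i B t`
with `B t = ∫₀ᵗ e^{iuD} W e^{-iuD} du` (`rotatedIntegral`). Both `U` and
`B` satisfy cocycle identities in time, so the remainder `R t = U t - 1 + i B t` obeys the doubling
inequality `‖R (2t)‖ ≤ 2 ‖R t‖ + ‖U t - 1‖²` (`norm_dysonRemainder_two_mul_le`). If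
`‖B (2ᵏ)‖ ≤ b √2ᵏ` for `k < X`, this gives `‖R (2ᵏ)‖ ≲ X b² 2ᵏ`, one contribution `b² 2ᵏ` for each
dyadic scale, as long as `X b² 2ᵏ ≲ 1`. Arbitrary times follow by binary expansion, since
the distance of two unitary groups is subadditive in time (`norm_evol_sub_le`). With
`l = log lam⁻¹`, `X ≈ 3l` and `b = lam K l² / (4 √X)` the resulting bound is at most
`K l² lam √t` for all times at which that quantity is less than `2`, and for the other times the
estimate is trivial.

It remains to bound `B h` for `≈ 3l` values of `h`. In the Fourier basis `B h` is `lam` times a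
Gaussian matrix series `∑ₓ Vₓ Aₓ` whose variance matrix `∑ₓ Aₓ²` is diagonal, with entries
`L^{-d} ∑ₗ |∫₀ʰ e^{iu(ωₖ - ωₗ)} du|²`. Gaussian integration by parts for the trace moments
(noncommutative Khintchine) bounds the norm of the series by the square root of the largest of
these entries times `√(log L)`, with Gaussian tails (`measureReal_norm_gaussianSeries_ge_le`). The
squared integral is a positive superposition of cosines, so for `d ≥ 2` the factorisation of the
return amplitude over the coordinates bounds the entries by their analogue for pairs of eigenvalues
`2 cos (2πk/L)` of the cycle (`sum_norm_expIntegral_torus_sq_le`). There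
`cos α - cos β = -2 sin ((α - β) / 2) sin ((α + β) / 2)` and a harmonic sum give `O(h log L)`
(`sum_norm_expIntegral_sq_le`). The variance is therefore `O(h l)`, while the squared threshold
`(K l² / (4 √X))² h` is of order `K² l³ h`. Their quotient `K² l²` exceeds the logarithm `O(d l)`
of the number of sites once `lam` is small in terms of `K₀`, and the union bound closes.
-/

noncomputable section

namespace Anderson

/-! ### Propagators in the interaction picture -/

section Deterministic

open NormedSpace

variable {A : Type*} [CStarAlgebra A]

/-- The propagator `e^{-ita}` of an element `a` of a C⋆-algebra. -/
def evol (a : A) (t : ℝ) : A := exp ((-(Complex.I * (t : ℂ))) • a)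

lemma evol_zero (a : A) : evol a 0 = 1 := by simp [evol]

lemma evol_add (a : A) (s t : ℝ) : evol a (s + t) = evol a s * evol a t := by
  let +nondep : NormedAlgebra ℚ A := .restrictScalars ℚ ℂ A
  unfold evol
  rw [← exp_add_of_commute, ← add_smul]
  · congr 2; push_cast; ring
  · exact (Commute.refl a).smul_left _ |>.smul_right _

lemma evol_neg_mul (a : A) (t : ℝ) : evol a (-t) * evol a t = 1 := by
  rw [← evol_add, neg_add_cancel, evol_zero]

lemma evol_mul_neg (a : A) (t : ℝ) : evol a t * evol a (-t) = 1 := by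
  rw [← evol_add, add_neg_cancel, evol_zero]

lemma commute_evol (a : A) (t : ℝ) : a * evol a t = evol a t * a :=
  (((Commute.refl a).smul_right _).exp_right).eq

lemma star_evol {a : A} (ha : IsSelfAdjoint a) (t : ℝ) : star (evol a t) = evol a (-t) := by
  unfold evol
  rw [star_exp, star_smul, ha.star_eq]
  congr 2
  simp

lemma evol_mem_unitary {a : A} (ha : IsSelfAdjoint a) (t : ℝ) : evol a t ∈ unitary A := by
  rw [Unitary.mem_iff, star_evol ha]
  exact ⟨evol_neg_mul a t, evol_mul_neg a t⟩

lemma norm_evol_mul {a : A} (ha : IsSelfAdjoint a) (t : ℝ) (x : A) : ‖evol a t * x‖ = ‖x‖ :=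
  CStarRing.norm_coe_unitary_mul ⟨_, evol_mem_unitary ha t⟩ x

lemma norm_mul_evol {a : A} (ha : IsSelfAdjoint a) (t : ℝ) (x : A) : ‖x * evol a t‖ = ‖x‖ :=
  CStarRing.norm_mul_coe_unitary x ⟨_, evol_mem_unitary ha t⟩

lemma norm_evol_le {a : A} (ha : IsSelfAdjoint a) (t : ℝ) : ‖evol a t‖ ≤ 1 := by
  rcases subsingleton_or_nontrivial A with h | h
  · simp [Subsingleton.elim (evol a t) 0]
  · exact (CStarRing.norm_of_mem_unitary (evol_mem_unitary ha t)).le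

lemma hasDerivAt_evol (a : A) (t : ℝ) :
    HasDerivAt (evol a) ((-Complex.I) • (a * evol a t)) t := by
  have h := hasDerivAt_exp_smul_const (𝕂 := ℝ) ((-Complex.I) • a) t
  have e : (fun u : ℝ => exp (u • ((-Complex.I) • a))) = evol a := by
    funext u
    simp only [evol]
    congr 1
    rw [← Complex.coe_smul, smul_smul]
    congr 1; ring
  have e' := congrFun e t
  rw [e, e'] at h
  convert! h using 1
  rw [mul_smul_comm, commute_evol]

lemma continuous_evol (a : A) : Continuous (evol a) :=
  continuous_iff_continuousAt.2 fun t => (hasDerivAt_evol a t).continuousAt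

/-- The perturbation `V` in the interaction picture of `D`: `e^{itD} V e^{-itD}`. -/
def rotated (D V : A) (t : ℝ) : A := evol D (-t) * V * evol D t

/-- The integrated perturbation `∫₀ᵗ e^{iuD} V e^{-iuD} du`, that is, up to the factor `-i` the
first-order term of the Dyson series. -/
def rotatedIntegral (D V : A) (t : ℝ) : A := ∫ u in (0 : ℝ)..t, rotated D V u

/-- The propagator of `D + V` in the interaction picture of `D`. -/
def interaction (D V : A) (t : ℝ) : A := evol D (-t) * evol (D + V) t

/-- The part of the Dyson series of `interaction D V t` of order at least two. -/
def dysonRemainder (D V : A) (t : ℝ) : A :=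
  interaction D V t - 1 + Complex.I • rotatedIntegral D V t

lemma continuous_rotated (D V : A) : Continuous (rotated D V) :=
  (((continuous_evol D).comp continuous_neg).mul continuous_const).mul (continuous_evol D)

lemma hasDerivAt_rotatedIntegral (D V : A) (t : ℝ) :
    HasDerivAt (rotatedIntegral D V) (rotated D V t) t :=
  (continuous_rotated D V).integral_hasStrictDerivAt 0 t |>.hasDerivAt

lemma norm_rotated {D : A} (hD : IsSelfAdjoint D) (V : A) (t : ℝ) : ‖rotated D V t‖ = ‖V‖ := by
  rw [rotated, norm_mul_evol hD, norm_evol_mul hD]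

lemma rotated_add (D V : A) (s t : ℝ) :
    rotated D V (t + s) = evol D (-s) * rotated D V t * evol D s := by
  simp only [rotated, neg_add_rev, evol_add, mul_assoc]

lemma rotatedIntegral_add (D V : A) (s t : ℝ) :
    rotatedIntegral D V (s + t)
      = evol D (-s) * rotatedIntegral D V t * evol D s + rotatedIntegral D V s := by
  have hi : ∀ a b : ℝ, IntervalIntegrable (rotated D V) MeasureTheory.volume a b :=
    fun a b => (continuous_rotated D V).intervalIntegrable a b
  unfold rotatedIntegral
  rw [← intervalIntegral.integral_add_adjacent_intervals (hi 0 s) (hi s (s + t)), add_comm]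
  congr 1
  have h1 := intervalIntegral.integral_comp_add_right (a := 0) (b := t) (rotated D V) s
  rw [zero_add, add_comm t s] at h1
  rw [← h1]
  simp only [rotated_add]
  have h2 := ((ContinuousLinearMap.mul ℝ A).flip (evol D s) ∘L
    (ContinuousLinearMap.mul ℝ A) (evol D (-s))).intervalIntegral_comp_comm (hi 0 t)
  simpa using h2

lemma interaction_add (D V : A) (s t : ℝ) :
    interaction D V (s + t) = evol D (-s) * interaction D V t * evol D s * interaction D V s := by
  have h : evol D s * (evol D (-s) * evol (D + V) s) = evol (D + V) s := by
    rw [← mul_assoc, evol_mul_neg, one_mul]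
  simp only [interaction, mul_assoc]
  rw [h, neg_add, evol_add, add_comm s t, evol_add, mul_assoc]

lemma hasDerivAt_interaction (D V : A) (t : ℝ) :
    HasDerivAt (interaction D V) ((-Complex.I) • (rotated D V t * interaction D V t)) t := by
  have h1 : HasDerivAt (fun u : ℝ => evol D (-u)) (Complex.I • (D * evol D (-t))) t := by
    have := (hasDerivAt_evol D (-t)).scomp t (hasDerivAt_neg t)
    simpa [Function.comp_def] using this
  have h2 := h1.mul (hasDerivAt_evol (D + V) t)
  refine h2.congr_deriv ?_
  have e : rotated D V t * interaction D V t = evol D (-t) * V * evol (D + V) t := by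
    simp only [rotated, interaction, mul_assoc]
    rw [← mul_assoc (evol D t), evol_mul_neg, one_mul]
  rw [e, commute_evol D (-t)]
  simp only [mul_add, add_mul, smul_mul_assoc, neg_smul, smul_add, mul_assoc, mul_neg,
    mul_smul_comm]
  abel

lemma interaction_zero (D V : A) : interaction D V 0 = 1 := by
  simp [interaction, evol_zero]

lemma dysonRemainder_zero (D V : A) : dysonRemainder D V 0 = 0 := by
  simp [dysonRemainder, interaction_zero, rotatedIntegral]

lemma norm_evol_sub_eq {D : A} (hD : IsSelfAdjoint D) (V : A) (t : ℝ) :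
    ‖evol (D + V) t - evol D t‖ = ‖interaction D V t - 1‖ := by
  rw [← norm_evol_mul hD (-t), mul_sub, evol_neg_mul]
  rfl

lemma norm_evol_sub_evol_neg {D H : A} (hD : IsSelfAdjoint D) (hH : IsSelfAdjoint H) (t : ℝ) :
    ‖evol H (-t) - evol D (-t)‖ = ‖evol H t - evol D t‖ := by
  rw [← star_evol hD, ← star_evol hH, ← star_sub, norm_star]

lemma norm_evol_sub_evol_le_two {D H : A} (hD : IsSelfAdjoint D) (hH : IsSelfAdjoint H) (t : ℝ) :
    ‖evol H t - evol D t‖ ≤ 2 := by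
  linarith [norm_sub_le (evol H t) (evol D t), norm_evol_le hD t, norm_evol_le hH t]

/-- The distance between two unitary groups is subadditive in time. -/
lemma norm_evol_sub_evol_add_le {D H : A} (hD : IsSelfAdjoint D) (hH : IsSelfAdjoint H)
    (s t : ℝ) :
    ‖evol H (s + t) - evol D (s + t)‖ ≤ ‖evol H s - evol D s‖ + ‖evol H t - evol D t‖ := by
  have e : evol H (s + t) - evol D (s + t)
      = (evol H s - evol D s) * evol H t + evol D s * (evol H t - evol D t) := by
    rw [evol_add, evol_add]; noncomm_ring
  rw [e]
  refine (norm_add_le _ _).trans_eq ?_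
  rw [norm_mul_evol hH, norm_evol_mul hD]

lemma norm_interaction_sub_one_le {D V : A} (hD : IsSelfAdjoint D) (hV : IsSelfAdjoint V)
    {t : ℝ} (ht : 0 ≤ t) : ‖interaction D V t - 1‖ ≤ ‖V‖ * t := by
  have h := norm_image_sub_le_of_norm_deriv_le_segment' (f := interaction D V) (a := 0) (b := t)
    (C := ‖V‖) (fun x _ => (hasDerivAt_interaction D V x).hasDerivWithinAt) ?_ t ⟨ht, le_rfl⟩
  · simpa [interaction_zero] using h
  · intro x _
    rw [norm_smul, norm_neg, Complex.norm_I, one_mul, interaction, ← mul_assoc,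
      norm_mul_evol (hD.add hV), norm_mul_evol hD, norm_rotated hD]

lemma norm_dysonRemainder_le {D V : A} (hD : IsSelfAdjoint D) (hV : IsSelfAdjoint V)
    {t : ℝ} (ht : 0 ≤ t) : ‖dysonRemainder D V t‖ ≤ ‖V‖ ^ 2 * t ^ 2 := by
  have h := norm_image_sub_le_of_norm_deriv_le_segment' (f := dysonRemainder D V) (a := 0)
    (b := t) (C := ‖V‖ * (‖V‖ * t))
    (fun x _ => ((((hasDerivAt_interaction D V x).sub_const 1).add
      ((hasDerivAt_rotatedIntegral D V x).const_smul Complex.I))).hasDerivWithinAt) ?_ t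
      ⟨ht, le_rfl⟩
  · rw [dysonRemainder_zero, sub_zero, sub_zero] at h
    linarith
  · intro x hx
    have e : (-Complex.I) • (rotated D V x * interaction D V x) + Complex.I • rotated D V x
        = (-Complex.I) • (rotated D V x * (interaction D V x - 1)) := by
      rw [mul_sub, smul_sub, mul_one, neg_smul, neg_smul]; abel
    rw [e, norm_smul, norm_neg, Complex.norm_I, one_mul]
    refine (norm_mul_le _ _).trans ?_
    rw [norm_rotated hD]
    gcongr
    exact (norm_interaction_sub_one_le hD hV hx.1).trans
      (by have := hx.2.le; gcongr)

lemma dysonRemainder_add (D V : A) (s t : ℝ) :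
    dysonRemainder D V (s + t) = evol D (-s) * dysonRemainder D V t * evol D s
      + dysonRemainder D V s
      + evol D (-s) * (interaction D V t - 1) * evol D s * (interaction D V s - 1) := by
  have h := evol_neg_mul D s
  simp only [dysonRemainder, interaction_add, rotatedIntegral_add, smul_add, mul_add, add_mul,
    mul_sub, sub_mul, mul_one, mul_smul_comm, smul_mul_assoc, h, one_mul]
  abel

/-- Doubling the time doubles the remainder, up to a term that is quadratic in the distance of
the propagators. -/
lemma norm_dysonRemainder_two_mul_le {D : A} (hD : IsSelfAdjoint D) (V : A) (t : ℝ) :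
    ‖dysonRemainder D V (2 * t)‖ ≤ 2 * ‖dysonRemainder D V t‖ + ‖interaction D V t - 1‖ ^ 2 := by
  rw [two_mul t, dysonRemainder_add]
  refine (norm_add₃_le).trans ?_
  have h1 : ‖evol D (-t) * dysonRemainder D V t * evol D t‖ = ‖dysonRemainder D V t‖ := by
    rw [norm_mul_evol hD, norm_evol_mul hD]
  have h2 := norm_mul_le (evol D (-t) * (interaction D V t - 1) * evol D t)
    (interaction D V t - 1)
  rw [norm_mul_evol hD, norm_evol_mul hD] at h2
  rw [h1]
  linarith

lemma norm_interaction_sub_one_le_add (D V : A) (t : ℝ) :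
    ‖interaction D V t - 1‖ ≤ ‖dysonRemainder D V t‖ + ‖rotatedIntegral D V t‖ := by
  have e : interaction D V t - 1
      = dysonRemainder D V t - Complex.I • rotatedIntegral D V t := by
    simp [dysonRemainder]
  rw [e]
  refine (norm_sub_le _ _).trans_eq ?_
  rw [norm_smul, Complex.norm_I, one_mul]

/-- The remainder at dyadic times. Each doubling contributes `b² 2ᵏ` from the square of the
first-order term, which accounts for the factor `k + 1`; the second summand bounds what comes from
the square of the remainder itself. -/
lemma norm_dysonRemainder_two_pow_le {D V : A} (hD : IsSelfAdjoint D) (hV : IsSelfAdjoint V)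
    {b : ℝ} {X : ℕ} (hb : ‖V‖ ≤ b)
    (hB : ∀ k < X, ‖rotatedIntegral D V (2 ^ k)‖ ≤ b * √(2 ^ k)) (k : ℕ) (hk : k < X)
    (hs : 4 * X * b ^ 2 * 2 ^ k ≤ 1) :
    ‖dysonRemainder D V (2 ^ k)‖
      ≤ 2 ^ k * ((k + 1) * b ^ 2 + 4 * X ^ 2 * b ^ 4 * 2 ^ k) := by
  have hb0 : 0 ≤ b := (norm_nonneg _).trans hb
  induction k with
  | zero =>
    have h := norm_dysonRemainder_le hD hV (zero_le_one' ℝ)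
    have h2 : ‖V‖ ^ 2 ≤ b ^ 2 := by gcongr
    have h3 : 0 ≤ 4 * (X : ℝ) ^ 2 * b ^ 4 := by positivity
    simp only [pow_zero, Nat.cast_zero]
    nlinarith [sq_nonneg b]
  | succ k ih =>
    have hp : (0 : ℝ) < 2 ^ k := by positivity
    have hX : ((k : ℝ) + 1) ≤ X := by exact_mod_cast hk.le
    have hb2 : 0 ≤ b ^ 2 := sq_nonneg b
    have hs' : 4 * X * b ^ 2 * 2 ^ k ≤ 1 := by
      have : 0 ≤ 4 * X * b ^ 2 * 2 ^ k := by positivity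
      rw [pow_succ (2 : ℝ) k, ← mul_assoc] at hs
      linarith
    have ih := ih (by omega) hs'
    have hBk := hB k (by omega)
    have hsq : √((2 : ℝ) ^ k) ^ 2 = 2 ^ k := Real.sq_sqrt hp.le
    rw [pow_succ', Nat.cast_succ]
    have h1 := norm_dysonRemainder_two_mul_le hD V ((2 : ℝ) ^ k)
    have h2 := norm_interaction_sub_one_le_add D V ((2 : ℝ) ^ k)
    have hr : 0 ≤ ‖dysonRemainder D V (2 ^ k)‖ := norm_nonneg _
    have ha : 0 ≤ ‖interaction D V (2 ^ k) - 1‖ := norm_nonneg _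
    generalize ‖dysonRemainder D V (2 ^ k)‖ = r at *
    generalize ‖interaction D V (2 ^ k) - 1‖ = a at *
    generalize ‖rotatedIntegral D V (2 ^ k)‖ = β at *
    generalize √((2 : ℝ) ^ k) = q at *
    generalize (2 : ℝ) ^ k = p at *
    -- The hypothesis on `X b² 2ᵏ` makes the second summand of the bound at most `X b²`.
    obtain ⟨y, hy⟩ : ∃ y, y = (k + 1) * b ^ 2 + 4 * X ^ 2 * b ^ 4 * p := ⟨_, rfl⟩
    have hy0 : 0 ≤ y := by rw [hy]; positivity
    have hyX : y ≤ 2 * X * b ^ 2 := by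
      have e1 : (k + 1) * b ^ 2 ≤ X * b ^ 2 := by gcongr
      have e2 : X * b ^ 2 * (4 * X * b ^ 2 * p) ≤ X * b ^ 2 * 1 := by gcongr
      rw [hy]; linarith
    rw [← hy] at ih
    have h3 : a ^ 2 ≤ 2 * b ^ 2 * p + 2 * r ^ 2 := by
      have : a ^ 2 ≤ (r + b * q) ^ 2 := by gcongr; linarith
      nlinarith [sq_nonneg (r - b * q)]
    have h4 : r ^ 2 ≤ p ^ 2 * (2 * X * b ^ 2) ^ 2 := by
      rw [← mul_pow]; gcongr; exact ih.trans (by gcongr)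
    calc _ ≤ 2 * r + a ^ 2 := h1
      _ ≤ 2 * (p * y) + (2 * b ^ 2 * p + 2 * (p ^ 2 * (2 * X * b ^ 2) ^ 2)) := by linarith
      _ = _ := by rw [hy]; ring

lemma norm_evol_two_pow_sub_le {D V : A} (hD : IsSelfAdjoint D) (hV : IsSelfAdjoint V)
    {b : ℝ} {X : ℕ} (hb : ‖V‖ ≤ b)
    (hB : ∀ k < X, ‖rotatedIntegral D V (2 ^ k)‖ ≤ b * √(2 ^ k)) (k : ℕ) (hk : k < X)
    (hs : 4 * X * b ^ 2 * 2 ^ k ≤ 1) :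
    ‖evol (D + V) (2 ^ k) - evol D (2 ^ k)‖ ≤ b * √(2 ^ k) + 2 * X * b ^ 2 * 2 ^ k := by
  rw [norm_evol_sub_eq hD]
  have h1 := norm_dysonRemainder_two_pow_le hD hV hb hB k hk hs
  have h2 := norm_interaction_sub_one_le_add D V ((2 : ℝ) ^ k)
  have h3 := hB k hk
  have hX : ((k : ℝ) + 1) ≤ X := by exact_mod_cast hk
  have e1 : (k + 1) * b ^ 2 ≤ X * b ^ 2 := by gcongr
  have e2 : X * b ^ 2 * (4 * X * b ^ 2 * 2 ^ k) ≤ X * b ^ 2 * 1 := by gcongr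
  have e3 : (2 : ℝ) ^ k * ((k + 1) * b ^ 2 + 4 * X ^ 2 * b ^ 4 * 2 ^ k)
      ≤ 2 ^ k * (2 * X * b ^ 2) := by
    gcongr; linarith
  linarith

/-- Integer times, by binary expansion: the largest power of two is split off. -/
lemma norm_evol_natCast_sub_le {D V : A} (hD : IsSelfAdjoint D) (hV : IsSelfAdjoint V)
    {b : ℝ} {X : ℕ} (hb : ‖V‖ ≤ b)
    (hB : ∀ k < X, ‖rotatedIntegral D V (2 ^ k)‖ ≤ b * √(2 ^ k)) (n : ℕ) (hn : n < 2 ^ X)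
    (hs : 4 * X * b ^ 2 * n ≤ 1) :
    ‖evol (D + V) n - evol D n‖ ≤ 4 * b * √n + 2 * X * b ^ 2 * n := by
  have hb0 : 0 ≤ b := (norm_nonneg _).trans hb
  induction n using Nat.strong_induction_on with
  | _ n ih =>
  rcases Nat.eq_zero_or_pos n with rfl | hpos
  · simp [evol_zero]
  obtain ⟨k, hk1, hk2⟩ : ∃ k, 2 ^ k ≤ n ∧ n < 2 ^ (k + 1) :=
    ⟨Nat.log 2 n, Nat.pow_log_le_self 2 hpos.ne', Nat.lt_pow_succ_log_self (by norm_num) n⟩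
  obtain ⟨m, rfl⟩ := Nat.exists_eq_add_of_le hk1
  have hmk : m < 2 ^ k := by rw [pow_succ] at hk2; omega
  have hp : 0 < 2 ^ k := by positivity
  have hkX : k < X := (Nat.pow_lt_pow_iff_right (by norm_num : 1 < 2)).1 (hk1.trans_lt hn)
  push_cast at hs ⊢
  have hm0 : (0 : ℝ) ≤ m := by positivity
  have hp0 : (0 : ℝ) < 2 ^ k := by positivity
  have hXb : 0 ≤ 4 * (X : ℝ) * b ^ 2 := by positivity
  have h1 := norm_evol_two_pow_sub_le hD hV hb hB k hkX (by nlinarith)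
  have h2 := ih m (by omega) (by omega) (by nlinarith)
  have h3 := norm_evol_sub_evol_add_le hD (hD.add hV) (2 ^ k : ℝ) m
  -- The coefficient `4` is large enough for this because `m < 2 ^ k`.
  have h4 : √((2 : ℝ) ^ k) + 4 * √(m : ℝ) ≤ 4 * √(2 ^ k + m) := by
    have hmk' : (m : ℝ) ≤ 2 ^ k := by exact_mod_cast hmk.le
    have e1 := Real.sq_sqrt hp0.le
    have e2 := Real.sq_sqrt hm0
    have e3 := Real.sq_sqrt (add_nonneg hp0.le hm0)
    have e4 := Real.sqrt_le_sqrt hmk'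
    refine le_of_sq_le_sq ?_ (by positivity)
    have := Real.sqrt_nonneg (m : ℝ)
    have := Real.sqrt_nonneg ((2 : ℝ) ^ k)
    nlinarith
  have h5 := mul_le_mul_of_nonneg_left h4 hb0
  linarith

/-- Bounds on the first-order term of the Dyson series at dyadic times `2ᵏ`, `k < X`, and on the
perturbation itself control the distance of the propagators at all times up to `2 ^ X`, as long as
the second-order term `X b² t` is small. -/
theorem norm_evol_sub_le {D V : A} (hD : IsSelfAdjoint D) (hV : IsSelfAdjoint V)
    {b : ℝ} {X : ℕ} (hb : ‖V‖ ≤ b)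
    (hB : ∀ k < X, ‖rotatedIntegral D V (2 ^ k)‖ ≤ b * √(2 ^ k)) {t : ℝ} (ht : 0 ≤ t)
    (htX : t < 2 ^ X) (hs : 4 * X * b ^ 2 * t ≤ 1) :
    ‖evol (D + V) t - evol D t‖ ≤ 5 * b * √t + 2 * X * b ^ 2 * t := by
  have hb0 : 0 ≤ b := (norm_nonneg _).trans hb
  have hfl := Nat.floor_le ht
  have hX : 0 ≤ 2 * (X : ℝ) * b ^ 2 := by positivity
  have h1 := norm_evol_natCast_sub_le hD hV hb hB ⌊t⌋₊ ((Nat.floor_lt ht).2 (by simpa using htX))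
    (by nlinarith)
  have hf0 : 0 ≤ t - ⌊t⌋₊ := by linarith
  have hf1 : t - ⌊t⌋₊ ≤ 1 := by linarith [Nat.lt_floor_add_one t]
  have h2 := norm_interaction_sub_one_le hD hV hf0
  rw [← norm_evol_sub_eq hD] at h2
  have h3 := norm_evol_sub_evol_add_le hD (hD.add hV) (⌊t⌋₊ : ℝ) (t - ⌊t⌋₊)
  rw [add_sub_cancel] at h3
  have h4 : t - ⌊t⌋₊ ≤ √t := by
    refine (Real.le_sqrt hf0 ht).2 ?_
    nlinarith [Nat.cast_nonneg (α := ℝ) ⌊t⌋₊]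
  have h5 : √(⌊t⌋₊ : ℝ) ≤ √t := Real.sqrt_le_sqrt hfl
  have h6 : ‖V‖ * (t - ⌊t⌋₊) ≤ b * √t := by gcongr
  have h7 : 4 * b * √(⌊t⌋₊ : ℝ) ≤ 4 * b * √t := by gcongr
  have h8 : 2 * (X : ℝ) * b ^ 2 * ⌊t⌋₊ ≤ 2 * X * b ^ 2 * t := by gcongr
  linarith

end Deterministic

/-! ### Gaussian integration by parts for polynomials -/

section GaussianMoments

open MeasureTheory ProbabilityTheory

lemma integrable_pow_gaussianReal (n : ℕ) :
    Integrable (fun x : ℝ => x ^ n) (gaussianReal 0 1) := by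
  have h := (memLp_id_gaussianReal (μ := 0) (v := 1) n).integrable_norm_pow'
  refine (integrable_norm_iff (by fun_prop)).1 ?_
  simpa using h

lemma hasDerivAt_gaussianPDFReal (x : ℝ) :
    HasDerivAt (gaussianPDFReal 0 1) (-x * gaussianPDFReal 0 1 x) x := by
  have h : gaussianPDFReal 0 1
      = fun x : ℝ => (√(2 * Real.pi))⁻¹ * Real.exp (-x ^ 2 / 2) := by
    funext x; simp [gaussianPDFReal]
  rw [h]
  have h1 : HasDerivAt (fun x : ℝ => -x ^ 2 / 2) (-x) x := by
    have := ((hasDerivAt_pow 2 x).neg).div_const 2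
    convert! this using 1
    simp only [Nat.cast_ofNat]
    ring
  have := (h1.exp).const_mul (√(2 * Real.pi))⁻¹
  convert! this using 1
  ring

lemma integrable_gaussianPDFReal_mul_pow (n : ℕ) :
    Integrable (fun x : ℝ => gaussianPDFReal 0 1 x * x ^ n) := by
  have h := integrable_pow_gaussianReal n
  rw [gaussianReal_of_var_ne_zero 0 one_ne_zero,
    integrable_withDensity_iff_integrable_smul₀' (by fun_prop)
      (ae_of_all _ fun x => gaussianPDF_lt_top)] at h
  simpa using h

/-- The recursion for the moments of the standard Gaussian. For `n = 0` the factor `n` makes the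
value of the truncated exponent `n - 1` irrelevant. -/
lemma integral_pow_succ_gaussianReal (n : ℕ) :
    ∫ x : ℝ, x ^ (n + 1) ∂gaussianReal 0 1 = n * ∫ x : ℝ, x ^ (n - 1) ∂gaussianReal 0 1 := by
  rw [integral_gaussianReal_eq_integral_smul one_ne_zero,
    integral_gaussianReal_eq_integral_smul one_ne_zero]
  have hF : ∀ x : ℝ, HasDerivAt (fun x => gaussianPDFReal 0 1 x * x ^ n)
      (n * (gaussianPDFReal 0 1 x * x ^ (n - 1)) - gaussianPDFReal 0 1 x * x ^ (n + 1)) x := by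
    intro x
    refine ((hasDerivAt_gaussianPDFReal x).mul (hasDerivAt_pow n x)).congr_deriv ?_
    ring
  have i1 := (integrable_gaussianPDFReal_mul_pow (n - 1)).const_mul (n : ℝ)
  have i2 := integrable_gaussianPDFReal_mul_pow (n + 1)
  have h := integral_eq_zero_of_hasDerivAt_of_integrable hF (i1.sub i2)
    (integrable_gaussianPDFReal_mul_pow n)
  rw [integral_sub i1 i2, integral_const_mul] at h
  simp only [smul_eq_mul]
  linarith

variable {σ : Type*} [Fintype σ]

/-- The law of a family of independent standard Gaussians indexed by `σ`. -/
abbrev stdGaussians (σ : Type*) [Fintype σ] : Measure (σ → ℝ) :=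
  Measure.pi fun _ => gaussianReal 0 1

/-- The value of a complex polynomial at a real point. -/
abbrev evalReal (g : σ → ℝ) : MvPolynomial σ ℂ →+* ℂ := MvPolynomial.eval fun x => (g x : ℂ)

lemma evalReal_monomial (g : σ → ℝ) (m : σ →₀ ℕ) (a : ℂ) :
    evalReal g (MvPolynomial.monomial m a) = a * ((∏ x, g x ^ m x : ℝ) : ℂ) := by
  rw [MvPolynomial.eval_monomial, Finsupp.prod_fintype _ _ (by simp)]
  push_cast; rfl

lemma integrable_evalReal (p : MvPolynomial σ ℂ) :
    Integrable (fun g => evalReal g p) (stdGaussians σ) := by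
  induction p using MvPolynomial.induction_on' with
  | monomial m a =>
    simp only [evalReal_monomial]
    refine Integrable.const_mul (Integrable.ofReal ?_) a
    exact Integrable.fintype_prod (f := fun x (t : ℝ) => t ^ m x)
      fun x => integrable_pow_gaussianReal (m x)
  | add p q hp hq => simpa using! hp.add hq

/-- Gaussian integration by parts for polynomials. -/
lemma integral_evalReal_X_mul (x : σ) (p : MvPolynomial σ ℂ) :
    ∫ g, evalReal g (MvPolynomial.X x * p) ∂stdGaussians σ
      = ∫ g, evalReal g (MvPolynomial.pderiv x p) ∂stdGaussians σ := by
  classical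
  induction p using MvPolynomial.induction_on' with
  | monomial m a =>
    rw [MvPolynomial.X, MvPolynomial.monomial_mul, MvPolynomial.pderiv_monomial]
    simp only [evalReal_monomial]
    rw [integral_const_mul, integral_const_mul, integral_complex_ofReal, integral_complex_ofReal,
      integral_fintype_prod_eq_prod (f := fun y (t : ℝ) => t ^ _),
      integral_fintype_prod_eq_prod (f := fun y (t : ℝ) => t ^ _),
      ← Finset.mul_prod_erase Finset.univ
        (fun y => ∫ t : ℝ, t ^ ((Finsupp.single x 1 + m : σ →₀ ℕ) y) ∂gaussianReal 0 1)
        (Finset.mem_univ x),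
      ← Finset.mul_prod_erase Finset.univ
        (fun y => ∫ t : ℝ, t ^ ((m - Finsupp.single x 1 : σ →₀ ℕ) y) ∂gaussianReal 0 1)
        (Finset.mem_univ x)]
    have e : ∏ y ∈ Finset.univ.erase x, ∫ t : ℝ, t ^ ((Finsupp.single x 1 + m : σ →₀ ℕ) y)
          ∂gaussianReal 0 1
        = ∏ y ∈ Finset.univ.erase x, ∫ t : ℝ, t ^ ((m - Finsupp.single x 1 : σ →₀ ℕ) y)
          ∂gaussianReal 0 1 := by
      refine Finset.prod_congr rfl fun y hy => ?_
      have : x ≠ y := (Finset.ne_of_mem_erase hy).symm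
      simp [Finsupp.single_eq_of_ne' this]
    rw [e]
    have e2 : (Finsupp.single x 1 + m : σ →₀ ℕ) x = m x + 1 := by simp [add_comm]
    have e3 : (m - Finsupp.single x 1 : σ →₀ ℕ) x = m x - 1 := by simp
    rw [e2, e3, integral_pow_succ_gaussianReal]
    push_cast
    ring
  | add p q hp hq =>
    simp only [mul_add, map_add]
    rw [integral_add (integrable_evalReal _) (integrable_evalReal _),
      integral_add (integrable_evalReal _) (integrable_evalReal _), hp, hq]

end GaussianMoments

/-! ### Trace moments of Gaussian matrix series -/

section Matrices

open MeasureTheory ProbabilityTheory Matrix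

variable {σ n : Type*}

/-- The Gaussian matrix series `∑ₓ gₓ Aₓ`. -/
def gaussianSeries [Fintype σ] (A : σ → Matrix n n ℂ) (g : σ → ℝ) : Matrix n n ℂ :=
  ∑ x, (g x : ℂ) • A x

/-- The series `∑ₓ Xₓ Aₓ` in indeterminates `Xₓ`. -/
def polySeries [Fintype σ] (A : σ → Matrix n n ℂ) : Matrix n n (MvPolynomial σ ℂ) :=
  ∑ x, (MvPolynomial.X x : MvPolynomial σ ℂ) • (A x).map MvPolynomial.C

lemma mapMatrix_map_C [Fintype n] [DecidableEq n] (g : σ → ℝ) (B : Matrix n n ℂ) :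
    (evalReal g).mapMatrix (B.map MvPolynomial.C) = B := by
  ext i j; simp

lemma mapMatrix_polySeries [Fintype σ] [Fintype n] [DecidableEq n]
    (A : σ → Matrix n n ℂ) (g : σ → ℝ) :
    (evalReal g).mapMatrix (polySeries A) = gaussianSeries A g := by
  ext i j
  simp [polySeries, gaussianSeries, Matrix.sum_apply]

lemma evalReal_trace [Fintype n] [DecidableEq n] (g : σ → ℝ) (P : Matrix n n (MvPolynomial σ ℂ)) :
    evalReal g P.trace = ((evalReal g).mapMatrix P).trace := by
  simp [Matrix.trace]

lemma map_pderiv_mul [Fintype n] (x : σ) (P Q : Matrix n n (MvPolynomial σ ℂ)) :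
    (P * Q).map (MvPolynomial.pderiv x)
      = P.map (MvPolynomial.pderiv x) * Q + P * Q.map (MvPolynomial.pderiv x) := by
  refine Matrix.ext fun i j => ?_
  simp only [Matrix.map_apply, Matrix.add_apply, Matrix.mul_apply, map_sum,
    MvPolynomial.pderiv_mul, Finset.sum_add_distrib]

lemma map_pderiv_polySeries [Fintype σ] (A : σ → Matrix n n ℂ) (x : σ) :
    (polySeries A).map (MvPolynomial.pderiv x) = (A x).map MvPolynomial.C := by
  classical
  refine Matrix.ext fun i j => ?_
  simp [polySeries, Matrix.sum_apply, MvPolynomial.pderiv_X, Pi.single_apply]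

lemma map_pderiv_polySeries_pow [Fintype σ] [Fintype n] [DecidableEq n]
    (A : σ → Matrix n n ℂ) (x : σ) (m : ℕ) :
    (polySeries A ^ (m + 1)).map (MvPolynomial.pderiv x)
      = ∑ j ∈ Finset.range (m + 1),
        polySeries A ^ j * (A x).map MvPolynomial.C * polySeries A ^ (m - j) := by
  induction m with
  | zero => simp [map_pderiv_polySeries]
  | succ m ih =>
    rw [pow_succ, map_pderiv_mul, ih, map_pderiv_polySeries, Finset.sum_range_succ _ (m + 1),
      Finset.sum_mul, Nat.sub_self, pow_zero, mul_one]
    refine congrArg₂ (· + ·) ?_ rfl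
    refine Finset.sum_congr rfl fun j hj => ?_
    rw [Finset.mem_range] at hj
    rw [mul_assoc, ← pow_succ, show m + 1 - j = m - j + 1 by omega]

lemma trace_map_pderiv [Fintype n] (x : σ) (P : Matrix n n (MvPolynomial σ ℂ)) :
    MvPolynomial.pderiv x P.trace = (P.map (MvPolynomial.pderiv x)).trace := by
  simp [Matrix.trace]

lemma map_pderiv_map_C_mul [Fintype n] (x : σ) (B : Matrix n n ℂ)
    (P : Matrix n n (MvPolynomial σ ℂ)) :
    (B.map MvPolynomial.C * P).map (MvPolynomial.pderiv x)
      = B.map MvPolynomial.C * P.map (MvPolynomial.pderiv x) := by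
  rw [map_pderiv_mul]
  have : (B.map (MvPolynomial.C : ℂ →+* MvPolynomial σ ℂ)).map (MvPolynomial.pderiv x) = 0 := by
    ext i j; simp
  rw [this, zero_mul, zero_add]

lemma integrable_trace_gaussianSeries_pow [Fintype σ] [Fintype n] [DecidableEq n]
    (A : σ → Matrix n n ℂ) (m : ℕ) :
    Integrable (fun g => (gaussianSeries A g ^ m).trace) (stdGaussians σ) := by
  have h := integrable_evalReal (polySeries A ^ m).trace
  simpa only [evalReal_trace, map_pow, mapMatrix_polySeries] using h

lemma integrable_trace_mul_gaussianSeries [Fintype σ] [Fintype n] [DecidableEq n]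
    (A : σ → Matrix n n ℂ) (x : σ) (j k : ℕ) :
    Integrable (fun g => (A x * (gaussianSeries A g ^ j * A x * gaussianSeries A g ^ k)).trace)
      (stdGaussians σ) := by
  have h := integrable_evalReal ((A x).map MvPolynomial.C *
    (polySeries A ^ j * (A x).map MvPolynomial.C * polySeries A ^ k)).trace
  simpa only [evalReal_trace, map_mul, map_pow, mapMatrix_polySeries, mapMatrix_map_C] using h

/-- Gaussian integration by parts for the trace moments of a Gaussian matrix series. -/
lemma integral_trace_gaussianSeries_pow [Fintype σ] [Fintype n] [DecidableEq n]
    (A : σ → Matrix n n ℂ) (m : ℕ) :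
    ∫ g, (gaussianSeries A g ^ (m + 2)).trace ∂stdGaussians σ
      = ∑ j ∈ Finset.range (m + 1), ∑ x, ∫ g,
        (A x * (gaussianSeries A g ^ j * A x * gaussianSeries A g ^ (m - j))).trace
          ∂stdGaussians σ := by
  have e : ∀ g, (gaussianSeries A g ^ (m + 2)).trace = ∑ x, evalReal g (MvPolynomial.X x *
      ((A x).map MvPolynomial.C * polySeries A ^ (m + 1)).trace) := by
    intro g
    rw [← mapMatrix_polySeries, ← map_pow, ← evalReal_trace, pow_succ' _ (m + 1)]
    nth_rw 1 [polySeries]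
    rw [Finset.sum_mul, Matrix.trace_sum, map_sum]
    refine Finset.sum_congr rfl fun x _ => ?_
    rw [smul_mul_assoc, Matrix.trace_smul, smul_eq_mul]
  simp only [e]
  rw [integral_finsetSum _ fun x _ => integrable_evalReal _, Finset.sum_comm]
  refine Finset.sum_congr rfl fun x _ => ?_
  rw [integral_evalReal_X_mul, trace_map_pderiv, map_pderiv_map_C_mul, map_pderiv_polySeries_pow,
    Finset.mul_sum, Matrix.trace_sum]
  simp only [map_sum]
  rw [integral_finsetSum _ fun x _ => integrable_evalReal _]
  refine Finset.sum_congr rfl fun j _ => ?_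
  simp only [evalReal_trace, map_mul, map_pow, mapMatrix_polySeries, mapMatrix_map_C]

/-- Spectral decomposition of a Hermitian matrix, in matrix form. -/
lemma exists_eq_unitary_conj_diagonal [Fintype n] [DecidableEq n] {Y : Matrix n n ℂ}
    (hY : Y.IsHermitian) :
    ∃ (U : Matrix n n ℂ) (e : n → ℝ), U ∈ unitary (Matrix n n ℂ) ∧
      ∀ j : ℕ, Y ^ j = U * diagonal (fun i => (e i : ℂ) ^ j) * Uᴴ := by
  refine ⟨hY.eigenvectorUnitary, hY.eigenvalues, hY.eigenvectorUnitary.2, fun j => ?_⟩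
  have h := congrArg (· ^ j) hY.spectral_theorem
  rw [← map_pow, diagonal_pow, Unitary.conjStarAlgAut_apply] at h
  exact h

lemma pow_mul_pow_add_le {a b : ℝ} {j k q : ℕ} (h : j + k = 2 * q) :
    a ^ j * b ^ k + b ^ j * a ^ k ≤ a ^ (2 * q) + b ^ (2 * q) := by
  have key : ∀ x y : ℝ, 0 ≤ x → 0 ≤ y →
      x ^ j * y ^ k + y ^ j * x ^ k ≤ x ^ (2 * q) + y ^ (2 * q) := by
    intro x y hx hy
    have : 0 ≤ (x ^ j - y ^ j) * (x ^ k - y ^ k) := by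
      rcases le_total x y with hxy | hxy
      · exact mul_nonneg_of_nonpos_of_nonpos (sub_nonpos.2 (by gcongr)) (sub_nonpos.2 (by gcongr))
      · exact mul_nonneg (sub_nonneg.2 (by gcongr)) (sub_nonneg.2 (by gcongr))
    rw [← h, pow_add, pow_add]
    linarith
  have h1 := key |a| |b| (abs_nonneg a) (abs_nonneg b)
  have e : ∀ x : ℝ, |x| ^ (2 * q) = x ^ (2 * q) := fun x => (even_two_mul q).pow_abs x
  rw [e, e] at h1
  refine le_trans (add_le_add ?_ ?_) h1
  · rw [← abs_pow, ← abs_pow, ← abs_mul]; exact le_abs_self _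
  · rw [← abs_pow, ← abs_pow, ← abs_mul]; exact le_abs_self _

lemma re_trace_mul_diagonal_mul_diagonal [Fintype n] [DecidableEq n] {B : Matrix n n ℂ}
    (hB : B.IsHermitian) (e : n → ℝ) (j k : ℕ) :
    (B * diagonal (fun i => (e i : ℂ) ^ j) * B * diagonal (fun i => (e i : ℂ) ^ k)).trace.re
      = ∑ i, ∑ l, Complex.normSq (B i l) * (e l ^ j * e i ^ k) := by
  simp only [Matrix.trace, Matrix.diag, mul_diagonal, Complex.re_sum]
  refine Finset.sum_congr rfl fun i _ => ?_
  rw [Matrix.mul_apply, Finset.sum_mul, Complex.re_sum]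
  refine Finset.sum_congr rfl fun l _ => ?_
  rw [mul_diagonal, ← hB.apply l i]
  have : B i l * (e l : ℂ) ^ j * star (B i l) * (e i : ℂ) ^ k
      = ((Complex.normSq (B i l) * (e l ^ j * e i ^ k) : ℝ) : ℂ) := by
    push_cast
    rw [← Complex.mul_conj]
    simp only [Complex.star_def]
    ring
  rw [this, Complex.ofReal_re]

/-- In the eigenbasis of `Y` with eigenvalues `eᵢ` this is the inequality
`eₗʲ eᵢᵏ + eᵢʲ eₗᵏ ≤ eᵢʲ⁺ᵏ + eₗʲ⁺ᵏ` summed with the symmetric weights `|Bᵢₗ|²`. -/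
lemma re_trace_mul_pow_mul_pow_le [Fintype n] [DecidableEq n] {B Y : Matrix n n ℂ}
    (hB : B.IsHermitian) (hY : Y.IsHermitian) {j k q : ℕ} (h : j + k = 2 * q) :
    (B * (Y ^ j * B * Y ^ k)).trace.re ≤ (B * B * Y ^ (2 * q)).trace.re := by
  obtain ⟨U, e, hU, hpow⟩ := exists_eq_unitary_conj_diagonal hY
  have hU2 : U * Uᴴ = 1 := (Unitary.mem_iff.1 hU).2
  have hC : (Uᴴ * B * U).IsHermitian := Matrix.isHermitian_conjTranspose_mul_mul U hB
  have key : ∀ a b : ℕ, (B * (Y ^ a * B * Y ^ b)).trace.re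
      = ∑ i, ∑ l, Complex.normSq ((Uᴴ * B * U) i l) * (e l ^ a * e i ^ b) := by
    intro a b
    rw [← re_trace_mul_diagonal_mul_diagonal hC, hpow a, hpow b]
    congr 1
    rw [← Matrix.mul_assoc B, ← Matrix.mul_assoc _ _ Uᴴ, Matrix.trace_mul_comm _ Uᴴ]
    simp only [Matrix.mul_assoc]
  have e0 : (B * B * Y ^ (2 * q)).trace.re = (B * (Y ^ 0 * B * Y ^ (2 * q))).trace.re := by
    rw [pow_zero, Matrix.one_mul, Matrix.mul_assoc]
  rw [e0, key, key]
  set w : n → n → ℝ := fun i l => Complex.normSq ((Uᴴ * B * U) i l) with hw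
  have hsymm : ∀ i l, w i l = w l i := by
    intro i l
    simp only [hw]
    rw [← hC.apply i l, Complex.star_def, Complex.normSq_conj]
  have swap : ∀ F : n → n → ℝ, ∑ i, ∑ l, w i l * F i l = ∑ i, ∑ l, w i l * F l i := by
    intro F
    rw [Finset.sum_comm]
    exact Finset.sum_congr rfl fun i _ => Finset.sum_congr rfl fun l _ => by rw [hsymm]
  have h1 : 2 * ∑ i, ∑ l, w i l * (e l ^ j * e i ^ k)
      = ∑ i, ∑ l, w i l * (e l ^ j * e i ^ k + e i ^ j * e l ^ k) := by
    simp only [mul_add (w _ _), Finset.sum_add_distrib]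
    rw [swap fun i l => e i ^ j * e l ^ k]
    ring
  have h2 : 2 * ∑ i, ∑ l, w i l * (e l ^ 0 * e i ^ (2 * q))
      = ∑ i, ∑ l, w i l * (e l ^ (2 * q) + e i ^ (2 * q)) := by
    simp only [mul_add (w _ _), Finset.sum_add_distrib, pow_zero, one_mul]
    rw [swap fun i l => e l ^ (2 * q)]
    ring
  have h3 : ∑ i, ∑ l, w i l * (e l ^ j * e i ^ k + e i ^ j * e l ^ k)
      ≤ ∑ i, ∑ l, w i l * (e l ^ (2 * q) + e i ^ (2 * q)) :=
    Finset.sum_le_sum fun i _ => Finset.sum_le_sum fun l _ =>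
      mul_le_mul_of_nonneg_left (pow_mul_pow_add_le h) (Complex.normSq_nonneg _)
  show ∑ i, ∑ l, w i l * (e l ^ j * e i ^ k) ≤ ∑ i, ∑ l, w i l * (e l ^ 0 * e i ^ (2 * q))
  linarith

open scoped Matrix.Norms.L2Operator in
/-- The operator norm of a Hermitian matrix is at most its Schatten `2p`-norm. -/
lemma norm_pow_le_re_trace [Fintype n] [DecidableEq n] [Nonempty n] {Y : Matrix n n ℂ}
    (hY : Y.IsHermitian) (p : ℕ) : ‖Y‖ ^ (2 * p) ≤ (Y ^ (2 * p)).trace.re := by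
  obtain ⟨U, e, hU, hpow⟩ := exists_eq_unitary_conj_diagonal hY
  have hU1 : Uᴴ * U = 1 := (Unitary.mem_iff.1 hU).1
  have hn : ‖Y‖ = ‖fun i => (e i : ℂ)‖ := by
    have h := hpow 1
    simp only [pow_one] at h
    rw [h, ← Matrix.star_eq_conjTranspose,
      CStarRing.norm_mul_mem_unitary _ (Unitary.star_mem hU), CStarRing.norm_mem_unitary_mul _ hU,
      l2_opNorm_diagonal]
  have ht : (Y ^ (2 * p)).trace.re = ∑ i, e i ^ (2 * p) := by
    rw [hpow, Matrix.trace_mul_comm, ← Matrix.mul_assoc, hU1, Matrix.one_mul,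
      Matrix.trace_diagonal, Complex.re_sum]
    exact Finset.sum_congr rfl fun i _ => by rw [← Complex.ofReal_pow, Complex.ofReal_re]
  obtain ⟨i, hi⟩ := Finite.exists_max fun i => ‖(e i : ℂ)‖
  have hn' : ‖Y‖ ≤ |e i| := by
    rw [hn]
    refine (pi_norm_le_iff_of_nonneg (abs_nonneg _)).2 fun l => ?_
    simpa using hi l
  calc ‖Y‖ ^ (2 * p) ≤ |e i| ^ (2 * p) := by gcongr
    _ = e i ^ (2 * p) := (even_two_mul p).pow_abs _
    _ ≤ ∑ i, e i ^ (2 * p) :=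
      Finset.single_le_sum (f := fun i => e i ^ (2 * p))
        (fun i _ => (even_two_mul p).pow_nonneg _) (Finset.mem_univ i)
    _ = _ := ht.symm

lemma isHermitian_gaussianSeries [Fintype σ] {A : σ → Matrix n n ℂ}
    (hA : ∀ x, (A x).IsHermitian) (g : σ → ℝ) : (gaussianSeries A g).IsHermitian := by
  unfold gaussianSeries Matrix.IsHermitian
  rw [Matrix.conjTranspose_sum]
  refine Finset.sum_congr rfl fun x _ => ?_
  rw [Matrix.conjTranspose_smul, (hA x).eq]
  simp

lemma re_trace_diagonal_mul_pow_le [Fintype n] [DecidableEq n] {Y : Matrix n n ℂ}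
    (hY : Y.IsHermitian) {f : n → ℝ} {s : ℝ} (hf : ∀ i, f i ≤ s) (q : ℕ) :
    (diagonal (fun i => (f i : ℂ)) * Y ^ (2 * q)).trace.re ≤ s * (Y ^ (2 * q)).trace.re := by
  simp only [Matrix.trace, Matrix.diag, diagonal_mul, Complex.re_sum, Finset.mul_sum]
  refine Finset.sum_le_sum fun i _ => ?_
  rw [Complex.re_ofReal_mul]
  refine mul_le_mul_of_nonneg_right (hf i) ?_
  rw [two_mul, pow_add, Matrix.mul_apply, Complex.re_sum]
  refine Finset.sum_nonneg fun l _ => ?_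
  rw [← (hY.pow q).apply l i, Complex.star_def, Complex.mul_conj, Complex.ofReal_re]
  exact Complex.normSq_nonneg _

/-- One step of the noncommutative Khintchine recursion. -/
lemma integral_re_trace_pow_succ_le [Fintype σ] [Fintype n] [DecidableEq n]
    {A : σ → Matrix n n ℂ} (hA : ∀ x, (A x).IsHermitian) {f : n → ℝ} {s : ℝ}
    (hS : ∑ x, A x * A x = diagonal fun i => (f i : ℂ)) (hf : ∀ i, f i ≤ s) (q : ℕ) :
    ∫ g, (gaussianSeries A g ^ (2 * (q + 1))).trace.re ∂stdGaussians σ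
      ≤ (2 * q + 1) * s * ∫ g, (gaussianSeries A g ^ (2 * q)).trace.re ∂stdGaussians σ := by
  have hre := fun m => (integrable_trace_gaussianSeries_pow A m).re
  have e1 : ∫ g, (gaussianSeries A g ^ (2 * (q + 1))).trace.re ∂stdGaussians σ
      = ∑ j ∈ Finset.range (2 * q + 1), ∫ g, ∑ x,
        (A x * (gaussianSeries A g ^ j * A x * gaussianSeries A g ^ (2 * q - j))).trace.re
          ∂stdGaussians σ := by
    have h1 := integral_re (integrable_trace_gaussianSeries_pow A (2 * q + 2))
    have h2 := congrArg Complex.re (integral_trace_gaussianSeries_pow A (2 * q))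
    rw [mul_add, mul_one]
    refine h1.trans (h2.trans ?_)
    rw [Complex.re_sum]
    refine Finset.sum_congr rfl fun j _ => ?_
    have hi : ∀ x, Integrable (fun g => (A x * (gaussianSeries A g ^ j * A x *
        gaussianSeries A g ^ (2 * q - j))).trace.re) (stdGaussians σ) :=
      fun x => (integrable_trace_mul_gaussianSeries A x _ _).re
    rw [integral_finsetSum _ fun x _ => hi x, Complex.re_sum]
    exact Finset.sum_congr rfl fun x _ =>
      (integral_re (integrable_trace_mul_gaussianSeries A x _ _)).symm
  rw [e1]
  have e2 : ∀ j ∈ Finset.range (2 * q + 1), ∫ g, ∑ x,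
        (A x * (gaussianSeries A g ^ j * A x * gaussianSeries A g ^ (2 * q - j))).trace.re
          ∂stdGaussians σ
      ≤ s * ∫ g, (gaussianSeries A g ^ (2 * q)).trace.re ∂stdGaussians σ := by
    intro j hj
    rw [Finset.mem_range] at hj
    rw [← integral_const_mul]
    refine integral_mono
      (integrable_finsetSum _ fun x _ => (integrable_trace_mul_gaussianSeries A x _ _).re)
      ((hre _).const_mul s) fun g => ?_
    have hY := isHermitian_gaussianSeries hA g
    refine le_trans (Finset.sum_le_sum fun x _ =>
      re_trace_mul_pow_mul_pow_le (hA x) hY (q := q) (by omega)) ?_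
    rw [← Complex.re_sum, ← Matrix.trace_sum, ← Finset.sum_mul, hS]
    exact re_trace_diagonal_mul_pow_le hY hf q
  refine (Finset.sum_le_sum e2).trans_eq ?_
  rw [Finset.sum_const, Finset.card_range, nsmul_eq_mul]
  push_cast; ring

/-- The even trace moments of a Gaussian matrix series, in the form of a noncommutative Khintchine
inequality. -/
lemma integral_re_trace_pow_le [Fintype σ] [Fintype n] [DecidableEq n]
    {A : σ → Matrix n n ℂ} (hA : ∀ x, (A x).IsHermitian) {f : n → ℝ} {s : ℝ} (hs : 0 ≤ s)
    (hS : ∑ x, A x * A x = diagonal fun i => (f i : ℂ)) (hf : ∀ i, f i ≤ s) (p q : ℕ)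
    (hq : q ≤ p) :
    ∫ g, (gaussianSeries A g ^ (2 * q)).trace.re ∂stdGaussians σ
      ≤ (2 * p * s) ^ q * Fintype.card n := by
  induction q with
  | zero => simp [Matrix.trace]
  | succ q ih =>
    refine (integral_re_trace_pow_succ_le hA hS hf q).trans ?_
    have hqp : (q : ℝ) + 1 ≤ p := by exact_mod_cast hq
    calc (2 * q + 1) * s * ∫ g, (gaussianSeries A g ^ (2 * q)).trace.re ∂stdGaussians σ
        ≤ (2 * q + 1) * s * ((2 * p * s) ^ q * Fintype.card n) := by
          gcongr; exact ih (by omega)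
      _ ≤ (2 * p) * s * ((2 * p * s) ^ q * Fintype.card n) := by
          gcongr; linarith
      _ = _ := by ring

open scoped Matrix.Norms.L2Operator in
/-- Tail bound for the operator norm of a Gaussian matrix series. It follows from the trace moment
of order `2p` with `p` close to `u² / (2 e s)`. -/
theorem measureReal_norm_gaussianSeries_ge_le [Fintype σ] [Fintype n] [DecidableEq n] [Nonempty n]
    {A : σ → Matrix n n ℂ} (hA : ∀ x, (A x).IsHermitian) {f : n → ℝ} {s : ℝ} (hs : 0 < s)
    (hS : ∑ x, A x * A x = diagonal fun i => (f i : ℂ)) (hf : ∀ i, f i ≤ s) {u : ℝ} (hu : 0 < u) :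
    (stdGaussians σ).real {g | u ≤ ‖gaussianSeries A g‖}
      ≤ Fintype.card n * Real.exp (1 - u ^ 2 / (2 * Real.exp 1 * s)) := by
  -- With this `p` the moment bound `(2 p s / u²) ^ p` is at most `e ^ (-p)`.
  set p : ℕ := ⌊u ^ 2 / (2 * Real.exp 1 * s)⌋₊ with hp
  have he := Real.exp_pos 1
  have hp1 : (p : ℝ) ≤ u ^ 2 / (2 * Real.exp 1 * s) := Nat.floor_le (by positivity)
  have hp2 : u ^ 2 / (2 * Real.exp 1 * s) < p + 1 := Nat.lt_floor_add_one _
  have h1 := mul_meas_ge_le_integral_of_nonneg (μ := stdGaussians σ)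
    (f := fun g => (gaussianSeries A g ^ (2 * p)).trace.re)
    (Filter.Eventually.of_forall fun g => le_trans (by positivity)
      (norm_pow_le_re_trace (isHermitian_gaussianSeries hA g) p))
    (integrable_trace_gaussianSeries_pow A (2 * p)).re (u ^ (2 * p))
  have h2 := integral_re_trace_pow_le hA hs.le hS hf p p le_rfl
  have h3 : (stdGaussians σ).real {g | u ≤ ‖gaussianSeries A g‖}
      ≤ (stdGaussians σ).real {g | u ^ (2 * p) ≤ (gaussianSeries A g ^ (2 * p)).trace.re} := by
    refine measureReal_mono fun g (hg : u ≤ _) => ?_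
    exact (pow_le_pow_left₀ hu.le hg _).trans
      (norm_pow_le_re_trace (isHermitian_gaussianSeries hA g) p)
  have h4 : 2 * p * s ≤ u ^ 2 * Real.exp (-1) := by
    rw [le_div_iff₀ (by positivity)] at hp1
    rw [Real.exp_neg, ← div_eq_mul_inv, le_div_iff₀ he]
    linarith
  have h5 : (2 * p * s) ^ p * Fintype.card n
      ≤ u ^ (2 * p) * (Fintype.card n * Real.exp (1 - u ^ 2 / (2 * Real.exp 1 * s))) := by
    calc (2 * p * s) ^ p * Fintype.card n ≤ (u ^ 2 * Real.exp (-1)) ^ p * Fintype.card n := by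
          gcongr
      _ = u ^ (2 * p) * (Fintype.card n * Real.exp (-p)) := by
          rw [mul_pow, ← pow_mul, ← Real.exp_nat_mul]; ring_nf
      _ ≤ _ := by gcongr; linarith
  have h6 : 0 < u ^ (2 * p) := by positivity
  refine h3.trans (le_of_mul_le_mul_left ?_ h6)
  exact h1.trans (h2.trans h5)

end Matrices

/-! ### Differences of the eigenvalues of the cycle -/

section ExponentialSums

/-- The integral `∫₀ʰ e^{iuy} du`. -/
def expIntegral (h y : ℝ) : ℂ := ∫ u in (0 : ℝ)..h, Complex.exp (Complex.I * (u * y : ℝ))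

lemma norm_expIntegral_le {h : ℝ} (hh : 0 ≤ h) (y : ℝ) : ‖expIntegral h y‖ ≤ h := by
  have := intervalIntegral.norm_integral_le_of_norm_le_const (a := (0 : ℝ)) (b := h) (C := 1)
    (f := fun u : ℝ => Complex.exp (Complex.I * (u * y : ℝ)))
    fun u _ => (Complex.norm_exp_I_mul_ofReal _).le
  rwa [one_mul, sub_zero, abs_of_nonneg hh] at this

lemma norm_expIntegral_mul_le (h y : ℝ) : ‖expIntegral h y‖ * |y| ≤ 2 := by
  rcases eq_or_ne y 0 with rfl | hy
  · simp
  have hc : Complex.I * (y : ℂ) ≠ 0 := mul_ne_zero Complex.I_ne_zero (by exact_mod_cast hy)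
  have e : expIntegral h y = (Complex.exp (Complex.I * (h * y : ℝ)) - 1) / (Complex.I * y) := by
    have := integral_exp_mul_complex (a := 0) (b := h) hc
    rw [expIntegral]
    convert this using 3
    · push_cast; ring_nf
    · push_cast; ring_nf
    · simp
  rw [e, norm_div, norm_mul, Complex.norm_I, one_mul, Complex.norm_real, Real.norm_eq_abs,
    div_mul_cancel₀ _ (abs_ne_zero.2 hy)]
  refine (norm_sub_le _ _).trans ?_
  rw [Complex.norm_exp_I_mul_ofReal, norm_one]; norm_num

lemma norm_expIntegral_sq_le {h : ℝ} (hh : 0 ≤ h) {y z : ℝ} (hz : 0 ≤ z) (hzy : z ≤ |y|) :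
    ‖expIntegral h y‖ ^ 2 ≤ 16 * h ^ 2 / (2 + h * z) ^ 2 := by
  have h1 := norm_expIntegral_le hh y
  have h2 := norm_expIntegral_mul_le h y
  have h0 := norm_nonneg (expIntegral h y)
  have h3 : ‖expIntegral h y‖ * (2 + h * z) ≤ 4 * h := by
    have : ‖expIntegral h y‖ * z ≤ 2 := (mul_le_mul_of_nonneg_left hzy h0).trans h2
    nlinarith
  have hpos : 0 < 2 + h * z := by positivity
  have e : 16 * h ^ 2 / (2 + h * z) ^ 2 = (4 * h / (2 + h * z)) ^ 2 := by rw [div_pow]; ring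
  rw [e]
  gcongr
  rwa [le_div_iff₀ hpos]

variable {L : ℕ} [NeZero L]

/-- The eigenvalue `2 cos (2πk/L)` of the nearest-neighbour Laplacian on the cycle of length `L`. -/
def cycleEigenvalue (k : ZMod L) : ℝ := 2 * (ZMod.stdAddChar k).re

lemma star_stdAddChar (k : ZMod L) : star (ZMod.stdAddChar k : ℂ) = ZMod.stdAddChar (-k) := by
  rw [ZMod.stdAddChar_apply, ZMod.stdAddChar_apply, AddChar.map_neg_eq_inv, Circle.coe_inv_eq_conj]
  rfl

lemma norm_stdAddChar (k : ZMod L) : ‖(ZMod.stdAddChar k : ℂ)‖ = 1 := by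
  rw [ZMod.stdAddChar_apply, Circle.norm_coe]

lemma ofReal_cycleEigenvalue (k : ZMod L) :
    (cycleEigenvalue k : ℂ) = ZMod.stdAddChar k + ZMod.stdAddChar (-k) := by
  rw [← star_stdAddChar, Complex.star_def, Complex.add_conj, cycleEigenvalue]

/-- This is the identity `cos α - cos β = -2 sin ((α - β) / 2) sin ((α + β) / 2)`, in a form that
makes sense for residue classes. -/
lemma abs_cycleEigenvalue_sub (k l : ZMod L) :
    |cycleEigenvalue k - cycleEigenvalue l|
      = ‖(ZMod.stdAddChar (k - l) - 1 : ℂ)‖ * ‖(ZMod.stdAddChar (k + l) - 1 : ℂ)‖ := by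
  have e : ((cycleEigenvalue k - cycleEigenvalue l : ℝ) : ℂ)
      = ZMod.stdAddChar (-k) * ((ZMod.stdAddChar (k - l) - 1) * (ZMod.stdAddChar (k + l) - 1)) := by
    push_cast
    rw [ofReal_cycleEigenvalue, ofReal_cycleEigenvalue]
    simp only [mul_sub, sub_mul, one_mul, mul_one, ← AddChar.map_add_eq_mul]
    ring_nf
  rw [← Real.norm_eq_abs, ← Complex.norm_real, e, norm_mul, norm_mul, norm_stdAddChar, one_mul]

lemma le_norm_stdAddChar_sub_one (k : ZMod L) :
    4 * (k.valMinAbs.natAbs : ℝ) / L ≤ ‖(ZMod.stdAddChar k - 1 : ℂ)‖ := by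
  have hL : (0 : ℝ) < L := by exact_mod_cast Nat.pos_of_ne_zero (NeZero.ne L)
  have hpi := Real.pi_pos
  set v : ℤ := k.valMinAbs with hv
  have e1 : (ZMod.stdAddChar k : ℂ) = Complex.exp (Complex.I * (2 * Real.pi * v / L : ℝ)) := by
    rw [← ZMod.coe_valMinAbs k, ← hv, ZMod.stdAddChar_coe]
    congr 1; push_cast; ring
  have h2 : (v.natAbs : ℝ) = |(v : ℝ)| := by rw [Nat.cast_natAbs, Int.cast_abs]
  have h3 : |(v : ℝ)| ≤ L / 2 := by
    rw [← h2]
    exact (Nat.cast_le.2 (ZMod.natAbs_valMinAbs_le k)).trans Nat.cast_div_le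
  rw [e1, Complex.norm_exp_I_mul_ofReal_sub_one, h2, Real.norm_eq_abs, abs_mul, abs_two]
  have habs : |2 * Real.pi * v / L / 2| = Real.pi * |(v : ℝ)| / L := by
    rw [abs_div, abs_div, abs_mul, abs_mul, abs_of_pos hL, abs_of_pos hpi, abs_two]; ring
  have h4 := Real.mul_abs_le_abs_sin (x := 2 * Real.pi * v / L / 2) (by
    rw [habs, div_le_div_iff₀ hL two_pos]; nlinarith)
  rw [habs] at h4
  have e2 : 4 * |(v : ℝ)| / L = 2 * (2 / Real.pi * (Real.pi * |(v : ℝ)| / L)) := by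
    field_simp; ring
  rw [e2]; linarith

lemma sum_two_mul_add_le {g : ZMod L → ℝ} (hg : ∀ b, 0 ≤ g b) (a : ZMod L) :
    ∑ k, g (2 * k + a) ≤ 2 * ∑ b, g b := by
  have hfib : ∀ b : ZMod L, (Finset.univ.filter fun k : ZMod L => 2 * k + a = b).card ≤ 2 := by
    intro b
    rcases (Finset.univ.filter fun k : ZMod L => 2 * k + a = b).eq_empty_or_nonempty with h | h
    · rw [h]; simp
    obtain ⟨k₀, hk₀⟩ := h
    have hk₀' := (Finset.mem_filter.1 hk₀).2
    refine le_trans ?_ (IsAddCyclic.card_nsmul_eq_zero_le (α := ZMod L) (n := 2) two_pos)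
    refine Finset.card_le_card_of_injOn (fun k => k - k₀) ?_ fun x _ y _ h => by simpa using h
    intro k hk
    have hk' := (Finset.mem_filter.1 hk).2
    refine Finset.mem_coe.2 (Finset.mem_filter.2 ⟨Finset.mem_univ _, ?_⟩)
    rw [nsmul_eq_mul]
    push_cast
    linear_combination hk' - hk₀'
  rw [← Finset.sum_fiberwise_of_maps_to (t := Finset.univ) (g := fun k => 2 * k + a)
    fun _ _ => Finset.mem_univ _, Finset.mul_sum]
  refine Finset.sum_le_sum fun b _ => ?_
  rw [Finset.sum_congr rfl fun k hk => by rw [(Finset.mem_filter.1 hk).2], Finset.sum_const,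
    nsmul_eq_mul]
  exact mul_le_mul_of_nonneg_right (by exact_mod_cast hfib b) (hg b)

lemma sum_natAbs_valMinAbs_le {g : ℕ → ℝ} (hg : ∀ m, 0 ≤ g m) :
    ∑ b : ZMod L, g b.valMinAbs.natAbs ≤ g 0 + 2 * ∑ m ∈ Finset.range (L - 1), g (m + 1) := by
  have h1 : ∑ b : ZMod L, g b.valMinAbs.natAbs
      = ∑ v ∈ Finset.range L, g (min v (L - v)) := by
    refine Finset.sum_nbij ZMod.val (fun b _ => Finset.mem_range.2 b.val_lt)
      (fun a _ b _ h => ZMod.val_injective L h) ?_ fun b _ => by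
        rw [ZMod.valMinAbs_natAbs_eq_min]
    intro v hv
    exact ⟨(v : ZMod L), Finset.mem_coe.2 (Finset.mem_univ _),
      ZMod.val_cast_of_lt (Finset.mem_range.1 hv)⟩
  obtain ⟨n, rfl⟩ : ∃ n, L = n + 1 := ⟨L - 1, by have := NeZero.ne L; omega⟩
  rw [h1, Finset.sum_range_succ', add_comm, Nat.add_sub_cancel]
  have h2 : ∑ m ∈ Finset.range n, g (min (m + 1) (n + 1 - (m + 1)))
      ≤ ∑ m ∈ Finset.range n, (g (m + 1) + g (n - 1 - m + 1)) := by
    refine Finset.sum_le_sum fun m hm => ?_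
    rw [Finset.mem_range] at hm
    rw [show n + 1 - (m + 1) = n - 1 - m + 1 by omega]
    rcases min_choice (m + 1) (n - 1 - m + 1) with h | h <;> rw [h]
    · linarith [hg (n - 1 - m + 1)]
    · linarith [hg (m + 1)]
  rw [Finset.sum_add_distrib, Finset.sum_range_reflect (fun m => g (m + 1)) n] at h2
  simp only [Nat.zero_min]
  linarith

lemma sum_one_div_one_add_mul_sq_le {κ : ℝ} (hκ : 0 < κ) (n : ℕ) :
    ∑ m ∈ Finset.range n, 1 / (1 + κ * ((m + 1 : ℕ) : ℝ)) ^ 2 ≤ 1 / κ := by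
  have h : ∑ m ∈ Finset.range n, 1 / (1 + κ * ((m + 1 : ℕ) : ℝ)) ^ 2
      ≤ 1 / κ * (1 - 1 / (1 + κ * n)) := by
    induction n with
    | zero => simp
    | succ n ih =>
      rw [Finset.sum_range_succ]
      have hp : 0 < 1 + κ * n := by positivity
      have hp' : 0 < 1 + κ * (n + 1) := by positivity
      have : 1 / (1 + κ * ((n : ℝ) + 1)) ^ 2
          ≤ 1 / κ * (1 / (1 + κ * n) - 1 / (1 + κ * (n + 1))) := by
        have e : 1 / κ * (1 / (1 + κ * n) - 1 / (1 + κ * (n + 1)))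
            = 1 / ((1 + κ * n) * (1 + κ * (n + 1))) := by
          field_simp; ring
        rw [e]
        apply one_div_le_one_div_of_le (by positivity)
        nlinarith
      push_cast at ih ⊢
      linarith
  refine h.trans (mul_le_of_le_one_right (by positivity) ?_)
  have : 0 ≤ 1 / (1 + κ * n) := by positivity
  linarith

/-- The inner sum of the counting argument, over the residue class `b`, for `a` away from zero. -/
lemma sum_kernel_le {h : ℝ} (hh : 0 < h) {a : ℝ} (ha : 0 < a) :
    ∑ b : ZMod L, 16 * h ^ 2 / (2 + h * (16 * a * b.valMinAbs.natAbs / L ^ 2)) ^ 2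
      ≤ 4 * h ^ 2 + h * L ^ 2 / a := by
  have hL : (0 : ℝ) < L := by exact_mod_cast Nat.pos_of_ne_zero (NeZero.ne L)
  have hκ : 0 < 8 * h * a / L ^ 2 := by positivity
  have h1 := sum_natAbs_valMinAbs_le (L := L)
    (g := fun m => 4 * h ^ 2 * (1 / (1 + 8 * h * a / L ^ 2 * (m : ℝ)) ^ 2)) fun m => by positivity
  have h2 := sum_one_div_one_add_mul_sq_le hκ (L - 1)
  have e : ∀ m : ℕ, 16 * h ^ 2 / (2 + h * (16 * a * m / L ^ 2)) ^ 2
      = 4 * h ^ 2 * (1 / (1 + 8 * h * a / L ^ 2 * (m : ℝ)) ^ 2) := by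
    intro m
    have : 2 + h * (16 * a * m / L ^ 2) = 2 * (1 + 8 * h * a / L ^ 2 * (m : ℝ)) := by ring
    rw [this, mul_pow, show (16 : ℝ) * h ^ 2 = 2 ^ 2 * (4 * h ^ 2) by ring,
      mul_div_mul_left _ _ (by norm_num), mul_one_div]
  simp only [e]
  refine h1.trans ?_
  rw [← Finset.mul_sum]
  have h3 : 4 * h ^ 2 * (1 / (8 * h * a / L ^ 2)) = h * L ^ 2 / (2 * a) := by
    field_simp; norm_num
  have h4 : 4 * h ^ 2 * ∑ m ∈ Finset.range (L - 1),
      1 / (1 + 8 * h * a / L ^ 2 * ((m + 1 : ℕ) : ℝ)) ^ 2 ≤ h * L ^ 2 / (2 * a) := by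
    rw [← h3]; gcongr
  have e5 : h * L ^ 2 / a = 2 * (h * L ^ 2 / (2 * a)) := by field_simp
  rw [e5]
  simp only [Nat.cast_zero, mul_zero, add_zero, one_pow, div_one, mul_one]
  linarith

/-- The sum over all pairs of eigenvalues of the cycle. Only one logarithm is lost, because the sum
over the second factor of the difference `|e^{2πi(k-l)/L} - 1| |e^{2πi(k+l)/L} - 1|` is carried
out before the sum over the first. -/
theorem sum_norm_expIntegral_sq_le {h : ℝ} (hh : 0 < h) (hhL : h ≤ L) :
    ∑ k : ZMod L, ∑ l : ZMod L, ‖expIntegral h (cycleEigenvalue k - cycleEigenvalue l)‖ ^ 2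
      ≤ L ^ 2 * (h * (28 + 4 * Real.log L)) := by
  have hL : (0 : ℝ) < L := by exact_mod_cast Nat.pos_of_ne_zero (NeZero.ne L)
  set G : ℕ → ℕ → ℝ := fun a b => 16 * h ^ 2 / (2 + h * (16 * a * b / L ^ 2)) ^ 2 with hG
  have hG0 : ∀ a b, 0 ≤ G a b := fun a b => by simp only [hG]; positivity
  have h1 : ∀ k l : ZMod L, ‖expIntegral h (cycleEigenvalue k - cycleEigenvalue l)‖ ^ 2
      ≤ G (k - l).valMinAbs.natAbs (k + l).valMinAbs.natAbs := by
    intro k l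
    refine norm_expIntegral_sq_le hh.le (by positivity) ?_
    rw [abs_cycleEigenvalue_sub]
    refine le_trans (le_of_eq ?_) (mul_le_mul (le_norm_stdAddChar_sub_one (k - l))
      (le_norm_stdAddChar_sub_one (k + l)) (by positivity) (norm_nonneg _))
    ring
  have h2 : ∑ k : ZMod L, ∑ l : ZMod L, G (k - l).valMinAbs.natAbs (k + l).valMinAbs.natAbs
      ≤ ∑ a : ZMod L, 2 * ∑ b : ZMod L, G a.valMinAbs.natAbs b.valMinAbs.natAbs := by
    rw [Finset.sum_comm]
    have e : ∀ l : ZMod L, ∑ k, G (k - l).valMinAbs.natAbs (k + l).valMinAbs.natAbs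
        = ∑ a : ZMod L, G a.valMinAbs.natAbs (2 * l + a).valMinAbs.natAbs := by
      intro l
      refine Fintype.sum_equiv (Equiv.subRight l) _ _ fun k => ?_
      simp only [Equiv.subRight_apply]
      congr 3; ring
    simp only [e]
    rw [Finset.sum_comm]
    exact Finset.sum_le_sum fun a _ => sum_two_mul_add_le
      (g := fun b => G a.valMinAbs.natAbs b.valMinAbs.natAbs) (fun b => hG0 _ _) a
  set F : ℕ → ℝ := fun a => if a = 0 then 4 * h ^ 2 * L else 4 * h ^ 2 + h * L ^ 2 / a with hF
  have hF0 : ∀ a, 0 ≤ F a := by intro a; simp only [hF]; split_ifs <;> positivity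
  have h3 : ∀ a : ZMod L, ∑ b : ZMod L, G a.valMinAbs.natAbs b.valMinAbs.natAbs
      ≤ F a.valMinAbs.natAbs := by
    intro a
    generalize a.valMinAbs.natAbs = m
    simp only [hF, hG]
    split_ifs with hm
    · simp only [hm, Nat.cast_zero, mul_zero, zero_mul, zero_div, add_zero, Finset.sum_const,
        Finset.card_univ, ZMod.card, nsmul_eq_mul]
      linarith
    · exact sum_kernel_le hh (by exact_mod_cast Nat.pos_of_ne_zero hm)
  have h4 := sum_natAbs_valMinAbs_le (L := L) hF0
  have h5 : ∑ m ∈ Finset.range (L - 1), F (m + 1)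
      ≤ 4 * h ^ 2 * (L - 1) + h * L ^ 2 * (1 + Real.log L) := by
    have e : ∀ m : ℕ, F (m + 1) = 4 * h ^ 2 + h * L ^ 2 * ((m + 1 : ℕ) : ℝ)⁻¹ := by
      intro m; simp only [hF]; rw [if_neg (Nat.succ_ne_zero m), div_eq_mul_inv]
    simp only [e]
    rw [Finset.sum_add_distrib, Finset.sum_const, Finset.card_range, ← Finset.mul_sum,
      nsmul_eq_mul, Nat.cast_sub (Nat.pos_of_ne_zero (NeZero.ne L)), Nat.cast_one]
    have hharm : ∑ m ∈ Finset.range (L - 1), (((m + 1 : ℕ) : ℝ))⁻¹ ≤ 1 + Real.log L := by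
      have h6 : ((harmonic L : ℚ) : ℝ) ≤ 1 + Real.log L := harmonic_le_one_add_log L
      have h7 : ((harmonic L : ℚ) : ℝ) = ∑ m ∈ Finset.range L, (((m + 1 : ℕ) : ℝ))⁻¹ := by
        rw [harmonic]; push_cast; rfl
      rw [h7] at h6
      refine le_trans (Finset.sum_le_sum_of_subset_of_nonneg ?_ fun _ _ _ => by positivity) h6
      exact Finset.range_subset_range.2 (Nat.sub_le _ _)
    have : h * (L : ℝ) ^ 2 * ∑ m ∈ Finset.range (L - 1), (((m + 1 : ℕ) : ℝ))⁻¹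
        ≤ h * L ^ 2 * (1 + Real.log L) := by gcongr
    linarith
  calc _ ≤ ∑ k : ZMod L, ∑ l : ZMod L, G (k - l).valMinAbs.natAbs (k + l).valMinAbs.natAbs :=
        Finset.sum_le_sum fun k _ => Finset.sum_le_sum fun l _ => h1 k l
    _ ≤ _ := h2
    _ ≤ 2 * ∑ a : ZMod L, F a.valMinAbs.natAbs := by
        rw [Finset.mul_sum]; exact Finset.sum_le_sum fun a _ => by linarith [h3 a]
    _ ≤ 2 * (F 0 + 2 * (4 * h ^ 2 * (L - 1) + h * L ^ 2 * (1 + Real.log L))) := by linarith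
    _ ≤ _ := by
        simp only [hF, if_true]
        have : h ^ 2 * L ≤ h * L ^ 2 := by nlinarith [mul_nonneg hh.le hL.le]
        nlinarith [sq_nonneg h]

end ExponentialSums

/-! ### Comparison of cosine sums -/

section PositiveDefiniteness

lemma re_expIntegral (h y : ℝ) : (expIntegral h y).re = ∫ u in (0 : ℝ)..h, Real.cos (u * y) := by
  have hc : Continuous fun u : ℝ => Complex.exp (Complex.I * (u * y : ℝ)) := by fun_prop
  have := Complex.reCLM.intervalIntegral_comp_comm (hc.intervalIntegrable
    (μ := MeasureTheory.volume) 0 h)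
  rw [expIntegral, ← Complex.reCLM_apply, ← this]
  refine intervalIntegral.integral_congr fun u _ => ?_
  simp only [Complex.reCLM_apply]
  rw [mul_comm, Complex.exp_ofReal_mul_I_re]

lemma im_expIntegral (h y : ℝ) : (expIntegral h y).im = ∫ u in (0 : ℝ)..h, Real.sin (u * y) := by
  have hc : Continuous fun u : ℝ => Complex.exp (Complex.I * (u * y : ℝ)) := by fun_prop
  have := Complex.imCLM.intervalIntegral_comp_comm (hc.intervalIntegrable
    (μ := MeasureTheory.volume) 0 h)
  rw [expIntegral, ← Complex.imCLM_apply, ← this]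
  refine intervalIntegral.integral_congr fun u _ => ?_
  simp only [Complex.imCLM_apply]
  rw [mul_comm, Complex.exp_ofReal_mul_I_im]

lemma star_expIntegral (h y : ℝ) : star (expIntegral h y) = expIntegral h (-y) := by
  rw [Complex.star_def]
  apply Complex.ext
  · rw [Complex.conj_re, re_expIntegral, re_expIntegral]; simp
  · rw [Complex.conj_im, im_expIntegral, im_expIntegral]; simp

lemma norm_expIntegral_sq_eq (h y : ℝ) :
    ‖expIntegral h y‖ ^ 2
      = ∫ u in (0 : ℝ)..h, ∫ v in (0 : ℝ)..h, Real.cos ((u - v) * y) := by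
  have e : ∀ u v : ℝ, Real.cos ((u - v) * y)
      = Real.cos (u * y) * Real.cos (v * y) + Real.sin (u * y) * Real.sin (v * y) := by
    intro u v; rw [sub_mul, Real.cos_sub]
  have hi : ∀ c : ℝ, IntervalIntegrable (fun v : ℝ => c * Real.cos (v * y))
      MeasureTheory.volume 0 h := fun c => Continuous.intervalIntegrable (by fun_prop) _ _
  have hi' : ∀ c : ℝ, IntervalIntegrable (fun v : ℝ => c * Real.sin (v * y))
      MeasureTheory.volume 0 h := fun c => Continuous.intervalIntegrable (by fun_prop) _ _
  simp only [e]
  rw [Complex.sq_norm, Complex.normSq_apply, re_expIntegral, im_expIntegral]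
  have e2 : ∀ u : ℝ, ∫ v in (0 : ℝ)..h,
      (Real.cos (u * y) * Real.cos (v * y) + Real.sin (u * y) * Real.sin (v * y))
      = (∫ v in (0 : ℝ)..h, Real.cos (v * y)) * Real.cos (u * y)
        + (∫ v in (0 : ℝ)..h, Real.sin (v * y)) * Real.sin (u * y) := by
    intro u
    rw [intervalIntegral.integral_add (hi _) (hi' _), intervalIntegral.integral_const_mul,
      intervalIntegral.integral_const_mul]
    ring
  simp only [e2]
  rw [intervalIntegral.integral_add (hi _) (hi' _), intervalIntegral.integral_const_mul,
    intervalIntegral.integral_const_mul]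

lemma sum_norm_expIntegral_sq_eq {ι : Type*} [Fintype ι] (h : ℝ) (y : ι → ℝ) :
    ∑ i, ‖expIntegral h (y i)‖ ^ 2
      = ∫ u in (0 : ℝ)..h, ∫ v in (0 : ℝ)..h, ∑ i, Real.cos ((u - v) * y i) := by
  simp only [norm_expIntegral_sq_eq]
  rw [← intervalIntegral.integral_finsetSum]
  · refine intervalIntegral.integral_congr fun u _ => ?_
    rw [intervalIntegral.integral_finsetSum]
    exact fun i _ => Continuous.intervalIntegrable (by fun_prop) _ _
  · intro i _
    refine Continuous.intervalIntegrable ?_ _ _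
    refine intervalIntegral.continuous_parametric_intervalIntegral_of_continuous' ?_ _ _
    fun_prop

/-- The square `|∫₀ʰ e^{iuy} du|²` is a positive superposition of the functions `y ↦ cos (s y)`,
so a comparison of cosine sums is inherited by it. -/
lemma sum_norm_expIntegral_sq_le_of_cos_le {ι κ : Type*} [Fintype ι] [Fintype κ] {y : ι → ℝ}
    {z : κ → ℝ} {C : ℝ}
    (hyz : ∀ s : ℝ, ∑ i, Real.cos (s * y i) ≤ C * ∑ m, Real.cos (s * z m)) {h : ℝ} (hh : 0 ≤ h) :
    ∑ i, ‖expIntegral h (y i)‖ ^ 2 ≤ C * ∑ m, ‖expIntegral h (z m)‖ ^ 2 := by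
  rw [sum_norm_expIntegral_sq_eq, sum_norm_expIntegral_sq_eq,
    ← intervalIntegral.integral_const_mul]
  refine intervalIntegral.integral_mono_on hh ?_ ?_ fun u _ => ?_
  · refine Continuous.intervalIntegrable ?_ _ _
    refine intervalIntegral.continuous_parametric_intervalIntegral_of_continuous' ?_ _ _
    fun_prop
  · refine Continuous.intervalIntegrable ?_ _ _
    refine continuous_const.mul ?_
    refine intervalIntegral.continuous_parametric_intervalIntegral_of_continuous' ?_ _ _
    fun_prop
  · rw [← intervalIntegral.integral_const_mul]
    exact intervalIntegral.integral_mono_on hh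
      (Continuous.intervalIntegrable (by fun_prop) _ _)
      (Continuous.intervalIntegrable (by fun_prop) _ _) fun v _ => hyz (u - v)

end PositiveDefiniteness

/-! ### The Laplacian on the torus in the Fourier basis -/

section Torus

open Matrix

variable {d L : ℕ} [NeZero L]

/-- The eigenvalues of the Laplacian on the torus. -/
def torusEigenvalue (k : Torus d L) : ℝ := ∑ i, cycleEigenvalue (k i)

/-- The sum `∑ₖ e^{-isxₖ}` over the eigenvalues `xₖ` of the cycle, that is, `L` times the return
amplitude at time `s` of the free evolution on the cycle. -/
def cycleAmplitude (L : ℕ) [NeZero L] (s : ℝ) : ℂ :=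
  ∑ k : ZMod L, Complex.exp (Complex.I * (-(s * cycleEigenvalue k) : ℝ))

lemma norm_cycleAmplitude_le (s : ℝ) : ‖cycleAmplitude L s‖ ≤ L := by
  refine (norm_sum_le _ _).trans ?_
  simp only [Complex.norm_exp_I_mul_ofReal, Finset.sum_const, Finset.card_univ, ZMod.card,
    nsmul_eq_mul, mul_one, le_refl]

lemma norm_cycleAmplitude_sq (s : ℝ) :
    ‖cycleAmplitude L s‖ ^ 2
      = ∑ p : ZMod L × ZMod L, Real.cos (s * (cycleEigenvalue p.1 - cycleEigenvalue p.2)) := by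
  have hre : (cycleAmplitude L s).re = ∑ k : ZMod L, Real.cos (s * cycleEigenvalue k) := by
    rw [cycleAmplitude, Complex.re_sum]
    refine Finset.sum_congr rfl fun k _ => ?_
    rw [mul_comm Complex.I, Complex.exp_ofReal_mul_I_re, Real.cos_neg]
  have him : (cycleAmplitude L s).im = -∑ k : ZMod L, Real.sin (s * cycleEigenvalue k) := by
    rw [cycleAmplitude, Complex.im_sum, ← Finset.sum_neg_distrib]
    refine Finset.sum_congr rfl fun k _ => ?_
    rw [mul_comm Complex.I, Complex.exp_ofReal_mul_I_im, Real.sin_neg]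
  rw [Complex.sq_norm, Complex.normSq_apply, hre, him, neg_mul_neg, Finset.sum_mul_sum,
    Finset.sum_mul_sum, ← Finset.sum_add_distrib, Fintype.sum_prod_type]
  refine Finset.sum_congr rfl fun k _ => ?_
  rw [← Finset.sum_add_distrib]
  refine Finset.sum_congr rfl fun l _ => ?_
  rw [mul_sub, Real.cos_sub]

lemma sum_exp_torusEigenvalue (s : ℝ) :
    ∑ l : Torus d L, Complex.exp (Complex.I * (-(s * torusEigenvalue l) : ℝ))
      = cycleAmplitude L s ^ d := by
  have h := Finset.prod_univ_sum (fun _ : Fin d => (Finset.univ : Finset (ZMod L)))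
    (fun _ k => Complex.exp (Complex.I * (-(s * cycleEigenvalue k) : ℝ)))
  rw [Fintype.piFinset_univ] at h
  have h2 : cycleAmplitude L s ^ d = ∏ _i : Fin d, cycleAmplitude L s := by simp
  rw [h2]
  simp only [cycleAmplitude]
  rw [h]
  refine Finset.sum_congr rfl fun l _ => ?_
  rw [← Complex.exp_sum, ← Finset.mul_sum]
  congr 2
  rw [torusEigenvalue, Finset.mul_sum, ← Finset.sum_neg_distrib]
  push_cast; rfl

lemma sum_cos_torusEigenvalue_le (hd : 2 ≤ d) (k : Torus d L) (s : ℝ) :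
    ∑ l : Torus d L, Real.cos (s * (torusEigenvalue k - torusEigenvalue l))
      ≤ L ^ (d - 2) * ∑ p : ZMod L × ZMod L,
        Real.cos (s * (cycleEigenvalue p.1 - cycleEigenvalue p.2)) := by
  have e : ∑ l : Torus d L, Real.cos (s * (torusEigenvalue k - torusEigenvalue l))
      = (Complex.exp (Complex.I * (s * torusEigenvalue k : ℝ)) * cycleAmplitude L s ^ d).re := by
    rw [← sum_exp_torusEigenvalue, Finset.mul_sum, Complex.re_sum]
    refine Finset.sum_congr rfl fun l _ => ?_
    rw [← Complex.exp_add, ← mul_add, ← Complex.ofReal_add, mul_comm Complex.I,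
      Complex.exp_ofReal_mul_I_re]
    congr 1; ring
  rw [e, ← norm_cycleAmplitude_sq]
  refine (Complex.re_le_norm _).trans ?_
  rw [norm_mul, Complex.norm_exp_I_mul_ofReal, one_mul, norm_pow]
  obtain ⟨n, rfl⟩ := Nat.exists_eq_add_of_le' hd
  rw [Nat.add_sub_cancel, pow_add]
  gcongr
  exact norm_cycleAmplitude_le s

/-- In dimension at least two the second moment of the time integral grows linearly up to a
logarithm. -/
theorem sum_norm_expIntegral_torus_sq_le (hd : 2 ≤ d) (k : Torus d L) {h : ℝ} (hh : 0 < h)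
    (hhL : h ≤ L) :
    ∑ l : Torus d L, ‖expIntegral h (torusEigenvalue k - torusEigenvalue l)‖ ^ 2
      ≤ L ^ d * (h * (28 + 4 * Real.log L)) := by
  refine (sum_norm_expIntegral_sq_le_of_cos_le (sum_cos_torusEigenvalue_le hd k) hh.le).trans ?_
  rw [Fintype.sum_prod_type]
  refine (mul_le_mul_of_nonneg_left (sum_norm_expIntegral_sq_le hh hhL) (by positivity)).trans_eq ?_
  rw [← mul_assoc, ← pow_add, Nat.sub_add_cancel hd]

/-- The character of the torus with frequency `k`. -/
def torusChar (k x : Torus d L) : ℂ := ∏ i, ZMod.stdAddChar (k i * x i)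

lemma torusChar_add (k x y : Torus d L) : torusChar k (x + y) = torusChar k x * torusChar k y := by
  simp only [torusChar, Pi.add_apply, mul_add, AddChar.map_add_eq_mul, Finset.prod_mul_distrib]

lemma star_torusChar (k x : Torus d L) : star (torusChar k x) = torusChar (-k) x := by
  simp only [torusChar, star_prod, star_stdAddChar, Pi.neg_apply, neg_mul]

lemma torusChar_neg_mul (k l x : Torus d L) :
    torusChar (-k) x * torusChar l x = torusChar (l - k) x := by
  simp only [torusChar, ← Finset.prod_mul_distrib, ← AddChar.map_add_eq_mul, Pi.neg_apply,
    Pi.sub_apply]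
  refine Finset.prod_congr rfl fun i _ => ?_
  congr 1; ring

lemma torusChar_single (k : Torus d L) (i : Fin d) (a : ZMod L) :
    torusChar k (Pi.single i a) = ZMod.stdAddChar (k i * a) := by
  rw [torusChar, Finset.prod_eq_single i]
  · simp
  · intro j _ hj; simp [Pi.single_eq_of_ne hj]
  · simp

lemma sum_torusChar (k : Torus d L) :
    ∑ x, torusChar k x = if k = 0 then (L : ℂ) ^ d else 0 := by
  have h := Finset.prod_univ_sum (fun _ : Fin d => (Finset.univ : Finset (ZMod L)))
    (fun i x => (ZMod.stdAddChar (k i * x) : ℂ))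
  rw [Fintype.piFinset_univ] at h
  simp only [torusChar]
  rw [← h]
  have h1 : ∀ i, ∑ x : ZMod L, (ZMod.stdAddChar (k i * x) : ℂ)
      = if k i = 0 then (L : ℂ) else 0 := by
    intro i
    have := AddChar.sum_mulShift (k i) (ZMod.isPrimitive_stdAddChar L)
    simpa [mul_comm] using this
  simp only [h1]
  split_ifs with hk
  · subst hk; simp
  · obtain ⟨i, hi⟩ := Function.ne_iff.1 hk
    exact Finset.prod_eq_zero (Finset.mem_univ i) (if_neg hi)

/-- The unitary matrix of the discrete Fourier transform on the torus; its columns are the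
normalised characters. -/
def fourierMatrix (d L : ℕ) [NeZero L] : Matrix (Torus d L) (Torus d L) ℂ :=
  Matrix.of fun x k => ((√((L : ℝ) ^ d))⁻¹ : ℝ) * torusChar k x

lemma star_fourierMatrix_mul (x k l : Torus d L) :
    star (fourierMatrix d L x k) * fourierMatrix d L x l
      = ((L : ℂ) ^ d)⁻¹ * torusChar (l - k) x := by
  simp only [fourierMatrix, Matrix.of_apply, star_mul', star_torusChar, Complex.star_def,
    Complex.conj_ofReal]
  rw [← torusChar_neg_mul]
  have e : (((√((L : ℝ) ^ d))⁻¹ : ℝ) : ℂ) * ((√((L : ℝ) ^ d))⁻¹ : ℝ) = ((L : ℂ) ^ d)⁻¹ := by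
    rw [← Complex.ofReal_mul, ← mul_inv, Real.mul_self_sqrt (by positivity)]
    push_cast; rfl
  rw [← e]; ring

lemma sum_star_fourierMatrix_mul (k l : Torus d L) :
    ∑ x, star (fourierMatrix d L x k) * fourierMatrix d L x l = if k = l then 1 else 0 := by
  simp only [star_fourierMatrix_mul]
  rw [← Finset.mul_sum, sum_torusChar]
  have hL : (L : ℂ) ^ d ≠ 0 := pow_ne_zero _ (by exact_mod_cast NeZero.ne L)
  simp only [sub_eq_zero, eq_comm (a := l)]
  split_ifs <;> simp [hL]

lemma fourierMatrix_conjTranspose_mul : (fourierMatrix d L)ᴴ * fourierMatrix d L = 1 := by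
  ext k l
  rw [Matrix.mul_apply, Matrix.one_apply, ← sum_star_fourierMatrix_mul]
  rfl

lemma fourierMatrix_mul_conjTranspose : fourierMatrix d L * (fourierMatrix d L)ᴴ = 1 :=
  mul_eq_one_comm.1 fourierMatrix_conjTranspose_mul

lemma fourierMatrix_mem_unitary :
    fourierMatrix d L ∈ unitary (Matrix (Torus d L) (Torus d L) ℂ) :=
  Unitary.mem_iff.2 ⟨fourierMatrix_conjTranspose_mul, fourierMatrix_mul_conjTranspose⟩

lemma laplacianMatrix_mul_fourierMatrix :
    laplacianMatrix d L * fourierMatrix d L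
      = fourierMatrix d L * diagonal fun k => (torusEigenvalue k : ℂ) := by
  ext x k
  rw [Matrix.mul_diagonal, Matrix.mul_apply]
  simp only [laplacianMatrix, Matrix.of_apply, Finset.sum_mul, add_mul, ite_mul, one_mul, zero_mul]
  rw [Finset.sum_comm]
  simp only [Finset.sum_add_distrib, Finset.sum_ite_eq', Finset.mem_univ, if_true]
  simp only [fourierMatrix, Matrix.of_apply, sub_eq_add_neg, ← Pi.single_neg, torusChar_add,
    torusChar_single, mul_one, mul_neg, torusEigenvalue]
  rw [Complex.ofReal_sum, Finset.mul_sum, ← Finset.sum_add_distrib]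
  refine Finset.sum_congr rfl fun i _ => ?_
  rw [ofReal_cycleEigenvalue]
  ring

lemma laplacianMatrix_eq :
    laplacianMatrix d L = fourierMatrix d L * (diagonal fun k => (torusEigenvalue k : ℂ))
      * (fourierMatrix d L)ᴴ := by
  rw [← laplacianMatrix_mul_fourierMatrix, Matrix.mul_assoc, fourierMatrix_mul_conjTranspose,
    Matrix.mul_one]

lemma isHermitian_laplacianMatrix : (laplacianMatrix d L).IsHermitian := by
  rw [laplacianMatrix_eq]
  refine Matrix.isHermitian_mul_mul_conjTranspose _ ?_
  rw [Matrix.isHermitian_diagonal_iff]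
  exact fun k => Complex.conj_ofReal _

open scoped Matrix.Norms.L2Operator

lemma evol_laplacianMatrix (t : ℝ) :
    evol (laplacianMatrix d L) t = fourierMatrix d L
      * (diagonal fun k => Complex.exp (Complex.I * (-(t * torusEigenvalue k) : ℝ)))
      * (fourierMatrix d L)ᴴ := by
  have hinv : (fourierMatrix d L)⁻¹ = (fourierMatrix d L)ᴴ :=
    Matrix.inv_eq_right_inv fourierMatrix_mul_conjTranspose
  have hu : IsUnit (fourierMatrix d L) :=
    ⟨⟨_, _, fourierMatrix_mul_conjTranspose, fourierMatrix_conjTranspose_mul⟩, rfl⟩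
  have e : (-(Complex.I * (t : ℂ))) • laplacianMatrix d L = fourierMatrix d L
      * (diagonal fun k => Complex.I * (-(t * torusEigenvalue k) : ℝ)) * (fourierMatrix d L)⁻¹ := by
    rw [hinv, laplacianMatrix_eq, ← Matrix.smul_mul, ← Matrix.mul_smul, ← Matrix.diagonal_smul]
    congr 3
    funext k
    simp only [Pi.smul_apply, smul_eq_mul]
    push_cast; ring
  rw [evol, e, Matrix.exp_conj _ _ hu, hinv, Matrix.exp_diagonal]
  congr 3
  funext k
  rw [Pi.coe_exp, Complex.exp_eq_exp_ℂ]

/-- The rank-one matrix of the site `x` in the interaction picture, integrated over time `h` and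
written in the Fourier basis. -/
def rotatedSite (d L : ℕ) [NeZero L] (h : ℝ) (x : Torus d L) :
    Matrix (Torus d L) (Torus d L) ℂ :=
  Matrix.of fun k l => expIntegral h (torusEigenvalue k - torusEigenvalue l)
    * (star (fourierMatrix d L x k) * fourierMatrix d L x l)

lemma isHermitian_rotatedSite (h : ℝ) (x : Torus d L) : (rotatedSite d L h x).IsHermitian := by
  ext k l
  simp only [rotatedSite, Matrix.conjTranspose_apply, Matrix.of_apply, star_mul', star_star,
    star_expIntegral, neg_sub]
  ring

lemma sum_rotatedSite_mul_self (h : ℝ) :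
    ∑ x, rotatedSite d L h x * rotatedSite d L h x = diagonal fun k =>
      ((((L : ℝ) ^ d)⁻¹ * ∑ l : Torus d L,
        ‖expIntegral h (torusEigenvalue k - torusEigenvalue l)‖ ^ 2 : ℝ) : ℂ) := by
  ext k m
  rw [Matrix.sum_apply]
  have e : ∀ x, (rotatedSite d L h x * rotatedSite d L h x) k m
      = (((L : ℂ) ^ d)⁻¹ * ∑ l : Torus d L, expIntegral h (torusEigenvalue k - torusEigenvalue l)
          * expIntegral h (torusEigenvalue l - torusEigenvalue m))
        * (star (fourierMatrix d L x k) * fourierMatrix d L x m) := by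
    intro x
    rw [Matrix.mul_apply, Finset.mul_sum, Finset.sum_mul]
    refine Finset.sum_congr rfl fun l _ => ?_
    have h1 := star_fourierMatrix_mul x l l
    have h2 : torusChar (0 : Torus d L) x = 1 := by simp [torusChar]
    rw [sub_self, h2, mul_one] at h1
    simp only [rotatedSite, Matrix.of_apply]
    rw [← h1]; ring
  simp only [e]
  rw [← Finset.mul_sum, sum_star_fourierMatrix_mul, Matrix.diagonal_apply]
  split_ifs with hkm
  · subst hkm
    rw [mul_one]
    push_cast
    congr 1
    refine Finset.sum_congr rfl fun l _ => ?_
    rw [← neg_sub (torusEigenvalue k), ← star_expIntegral, Complex.star_def, Complex.mul_conj,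
      Complex.normSq_eq_norm_sq]
    push_cast; rfl
  · rw [mul_zero]

/-- The integrated potential in the interaction picture is, in the Fourier basis, a Gaussian matrix
series. -/
lemma conj_rotatedIntegral_eq (V : Torus d L → ℝ) (h : ℝ) :
    (fourierMatrix d L)ᴴ * rotatedIntegral (laplacianMatrix d L)
        (diagonal fun x => (V x : ℂ)) h * fourierMatrix d L
      = gaussianSeries (rotatedSite d L h) V := by
  ext k l
  let T : Matrix (Torus d L) (Torus d L) ℂ →ₗ[ℂ] ℂ :=
    { toFun := fun A => ((fourierMatrix d L)ᴴ * A * fourierMatrix d L) k l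
      map_add' := fun A B => by rw [Matrix.mul_add, Matrix.add_mul, Matrix.add_apply]
      map_smul' := fun c A => by
        rw [Matrix.mul_smul, Matrix.smul_mul, Matrix.smul_apply, RingHom.id_apply] }
  have hT : ∀ A, T A = ((fourierMatrix d L)ᴴ * A * fourierMatrix d L) k l := fun _ => rfl
  have h1 := (LinearMap.toContinuousLinearMap T).intervalIntegral_comp_comm
    ((continuous_rotated (laplacianMatrix d L) (diagonal fun x => (V x : ℂ))).intervalIntegrable
      (μ := MeasureTheory.volume) 0 h)
  rw [← hT]
  refine h1.symm.trans ?_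
  have h2 : ∀ u : ℝ, T (rotated (laplacianMatrix d L) (diagonal fun x => (V x : ℂ)) u)
      = Complex.exp (Complex.I * (u * (torusEigenvalue k - torusEigenvalue l) : ℝ))
        * ∑ x, (V x : ℂ) * (star (fourierMatrix d L x k) * fourierMatrix d L x l) := by
    intro u
    rw [hT, rotated, evol_laplacianMatrix, evol_laplacianMatrix]
    have e3 : ∀ D₁ D₂ B : Matrix (Torus d L) (Torus d L) ℂ,
        (fourierMatrix d L)ᴴ * ((fourierMatrix d L * D₁ * (fourierMatrix d L)ᴴ) * B
          * (fourierMatrix d L * D₂ * (fourierMatrix d L)ᴴ)) * fourierMatrix d L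
        = D₁ * ((fourierMatrix d L)ᴴ * (B * fourierMatrix d L)) * D₂ := by
      intro D₁ D₂ B
      simp only [Matrix.mul_assoc, fourierMatrix_conjTranspose_mul, Matrix.mul_one]
      simp only [← Matrix.mul_assoc, fourierMatrix_conjTranspose_mul, Matrix.one_mul]
    rw [e3, Matrix.mul_diagonal, Matrix.diagonal_mul, Matrix.mul_apply]
    simp only [Matrix.diagonal_mul, Matrix.conjTranspose_apply]
    rw [mul_right_comm, ← Complex.exp_add, ← mul_add, ← Complex.ofReal_add]
    congr 1
    · congr 3; ring
    · exact Finset.sum_congr rfl fun x _ => by ring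
  simp only [LinearMap.coe_toContinuousLinearMap', h2]
  rw [intervalIntegral.integral_mul_const, gaussianSeries, Matrix.sum_apply, Finset.mul_sum]
  refine Finset.sum_congr rfl fun x _ => ?_
  simp only [Matrix.smul_apply, rotatedSite, Matrix.of_apply, smul_eq_mul, expIntegral]
  ring

lemma norm_rotatedIntegral_eq (V : Torus d L → ℝ) (h : ℝ) :
    ‖rotatedIntegral (laplacianMatrix d L) (diagonal fun x => (V x : ℂ)) h‖
      = ‖gaussianSeries (rotatedSite d L h) V‖ := by
  rw [← conj_rotatedIntegral_eq]
  generalize rotatedIntegral (laplacianMatrix d L) (diagonal fun x => (V x : ℂ)) h = B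
  have hF := fourierMatrix_mem_unitary (d := d) (L := L)
  rw [← Matrix.star_eq_conjTranspose, CStarRing.norm_mul_mem_unitary _ hF,
    CStarRing.norm_mem_unitary_mul _ (Unitary.star_mem hF)]

end Torus

/-! ### The Dyson estimate with high probability -/

section Assembly

open Matrix MeasureTheory
open scoped Matrix.Norms.L2Operator

variable {d L : ℕ} [NeZero L]

lemma propagator_toEuclideanCLM (M : Matrix (Torus d L) (Torus d L) ℂ) (t : ℝ) :
    propagator (toEuclideanCLM (𝕜 := ℂ) M) t = toEuclideanCLM (𝕜 := ℂ) (evol M t) := by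
  let +nondep : NormedAlgebra ℚ (Matrix (Torus d L) (Torus d L) ℂ) := .restrictScalars ℚ ℂ _
  have hc : Continuous (toEuclideanCLM (n := Torus d L) (𝕜 := ℂ)) :=
    AddMonoidHomClass.continuous_of_bound _ 1 fun x => by
      rw [one_mul, l2_opNorm_toEuclideanCLM]
  unfold propagator evol
  rw [NormedSpace.map_exp (toEuclideanCLM (n := Torus d L) (𝕜 := ℂ)) hc, map_smul]

lemma hamiltonian_eq (lam : ℝ) (V : Torus d L → ℝ) :
    hamiltonian lam V = toEuclideanCLM (𝕜 := ℂ)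
      (laplacianMatrix d L + (lam : ℂ) • diagonal fun x => (V x : ℂ)) := by
  rw [hamiltonian, laplacian, potentialOp, map_add, map_smul]

lemma norm_propagator_sub_eq (lam : ℝ) (V : Torus d L → ℝ) (t : ℝ) :
    ‖propagator (hamiltonian lam V) t - propagator (laplacian d L) t‖
      = ‖evol (laplacianMatrix d L + (lam : ℂ) • diagonal fun x => (V x : ℂ)) t
        - evol (laplacianMatrix d L) t‖ := by
  rw [hamiltonian_eq, laplacian, propagator_toEuclideanCLM, propagator_toEuclideanCLM, ← map_sub,
    l2_opNorm_toEuclideanCLM]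

lemma rotatedIntegral_smul (D V : Matrix (Torus d L) (Torus d L) ℂ) (c : ℂ) (t : ℝ) :
    rotatedIntegral D (c • V) t = c • rotatedIntegral D V t := by
  simp only [rotatedIntegral, rotated, mul_smul_comm, smul_mul_assoc]
  exact intervalIntegral.integral_smul c _

/-- The estimate for all times on the event that the first-order terms at dyadic times and the
potential are bounded by `M`. When `Q lam √|t| ≥ 2` there is nothing to prove. -/
lemma norm_propagator_sub_le {lam M Q : ℝ} {X : ℕ} (hlam : 0 < lam) (hM : 0 ≤ M) (hMQ : 10 * M ≤ Q)
    (hXM : 16 * X * M ^ 2 ≤ Q ^ 2) (hX : 4 ≤ Q ^ 2 * lam ^ 2 * 2 ^ X) {V : Torus d L → ℝ}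
    (hV : ‖(diagonal fun x => (V x : ℂ) : Matrix (Torus d L) (Torus d L) ℂ)‖ ≤ M)
    (hB : ∀ k < X, ‖gaussianSeries (rotatedSite d L (2 ^ k)) V‖ ≤ M * √(2 ^ k)) (t : ℝ) :
    ‖propagator (hamiltonian lam V) t - propagator (laplacian d L) t‖ ≤ Q * lam * √|t| := by
  rw [norm_propagator_sub_eq]
  have hD : IsSelfAdjoint (laplacianMatrix d L) := isHermitian_laplacianMatrix
  have hW : IsSelfAdjoint ((lam : ℂ) • (diagonal fun x => (V x : ℂ) :
      Matrix (Torus d L) (Torus d L) ℂ)) := by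
    refine IsSelfAdjoint.smul (Complex.conj_ofReal _) ?_
    exact (Matrix.isHermitian_diagonal_iff).2 fun x => Complex.conj_ofReal _
  set W : Matrix (Torus d L) (Torus d L) ℂ := (lam : ℂ) • diagonal fun x => (V x : ℂ) with hWdef
  have habs : ‖evol (laplacianMatrix d L + W) t - evol (laplacianMatrix d L) t‖
      = ‖evol (laplacianMatrix d L + W) |t| - evol (laplacianMatrix d L) |t|‖ := by
    rcases abs_choice t with h | h <;> rw [h]
    rw [norm_evol_sub_evol_neg hD (hD.add hW)]
  rw [habs]
  have ht := abs_nonneg t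
  generalize |t| = τ at ht ⊢
  have hQ : 0 ≤ Q := by linarith
  have hsq := Real.sq_sqrt ht
  have hs0 := Real.sqrt_nonneg τ
  rcases le_or_gt 2 (Q * lam * √τ) with hbig | hsmall
  · exact (norm_evol_sub_evol_le_two hD (hD.add hW) τ).trans hbig
  have hq0 : 0 ≤ Q * lam * √τ := by positivity
  have hq2 : Q ^ 2 * lam ^ 2 * τ < 4 := by
    have : Q ^ 2 * lam ^ 2 * τ = (Q * lam * √τ) ^ 2 := by rw [mul_pow, mul_pow, hsq]
    rw [this]; nlinarith
  have hnl : ‖(lam : ℂ)‖ = lam := by rw [Complex.norm_real, Real.norm_eq_abs, abs_of_pos hlam]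
  have h1 := norm_evol_sub_le hD hW (b := lam * M) (X := X)
    (by rw [hWdef, norm_smul, hnl]; gcongr)
    (fun k hk => by
      rw [hWdef, rotatedIntegral_smul, norm_smul, hnl, norm_rotatedIntegral_eq, mul_assoc]
      exact mul_le_mul_of_nonneg_left (hB k hk) hlam.le)
    ht (by
      by_contra hcon
      have : Q ^ 2 * lam ^ 2 * 2 ^ X ≤ Q ^ 2 * lam ^ 2 * τ :=
        mul_le_mul_of_nonneg_left (not_lt.1 hcon) (by positivity)
      linarith)
    (by
      have : 16 * X * M ^ 2 * (lam ^ 2 * τ) ≤ Q ^ 2 * (lam ^ 2 * τ) := by gcongr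
      rw [mul_pow]; nlinarith)
  refine h1.trans ?_
  have h2 : 2 * X * (lam * M) ^ 2 * τ ≤ Q * lam * √τ / 4 := by
    have e1 : 16 * X * M ^ 2 * (lam ^ 2 * τ) ≤ Q ^ 2 * (lam ^ 2 * τ) := by gcongr
    have e2 : Q ^ 2 * (lam ^ 2 * τ) = (Q * lam * √τ) * (Q * lam * √τ) := by
      nth_rw 1 [← hsq]; ring
    have e3 : (Q * lam * √τ) * (Q * lam * √τ) ≤ 2 * (Q * lam * √τ) := by gcongr
    have e4 : 2 * X * (lam * M) ^ 2 * τ = 16 * X * M ^ 2 * (lam ^ 2 * τ) / 8 := by ring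
    rw [e4]; linarith
  have h3 : 5 * (lam * M) * √τ ≤ Q * lam * √τ / 2 := by
    have : 10 * M * (lam * √τ) ≤ Q * (lam * √τ) := by gcongr
    linarith
  linarith

lemma card_torus : (Fintype.card (Torus d L) : ℝ) = (L : ℝ) ^ d := by
  rw [Fintype.card_fun, ZMod.card, Fintype.card_fin]; push_cast; rfl

lemma measureReal_norm_diagonal_ge_le {u : ℝ} (hu : 0 < u) :
    (potentialLaw d L).real
        {V | u ≤ ‖(diagonal fun x => (V x : ℂ) : Matrix (Torus d L) (Torus d L) ℂ)‖}
      ≤ L ^ d * Real.exp (1 - u ^ 2 / (2 * Real.exp 1)) := by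
  have e : ∀ V : Torus d L → ℝ, (diagonal fun x => (V x : ℂ))
      = gaussianSeries (fun x => Matrix.single x x (1 : ℂ)) V := by
    intro V
    simp only [gaussianSeries, Matrix.smul_single, smul_eq_mul, mul_one]
    exact (Matrix.sum_single_eq_diagonal _).symm
  have h := measureReal_norm_gaussianSeries_ge_le
    (A := fun x : Torus d L => Matrix.single x x (1 : ℂ)) (f := fun _ => 1) (s := 1)
    (fun x => by simp [Matrix.IsHermitian]) one_pos (by
      simp only [Matrix.single_mul_single_same, mul_one]
      exact (Matrix.sum_single_eq_diagonal _).trans (by simp))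
    (fun _ => le_rfl) hu
  rw [card_torus, mul_one] at h
  simpa only [e] using! h

lemma measureReal_norm_rotatedSite_ge_le (hd : 2 ≤ d) {h u : ℝ} (hh : 0 < h) (hhL : h ≤ L)
    (hu : 0 < u) :
    (potentialLaw d L).real {V | u * √h ≤ ‖gaussianSeries (rotatedSite d L h) V‖}
      ≤ L ^ d * Real.exp (1 - u ^ 2 / (2 * Real.exp 1 * (28 + 4 * Real.log L))) := by
  have hL1 : (1 : ℝ) ≤ L := by exact_mod_cast Nat.pos_of_ne_zero (NeZero.ne L)
  have hlog := Real.log_nonneg hL1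
  have hLd : (0 : ℝ) < (L : ℝ) ^ d := by positivity
  have key := measureReal_norm_gaussianSeries_ge_le (A := rotatedSite d L h)
    (isHermitian_rotatedSite h) (s := h * (28 + 4 * Real.log L)) (by positivity)
    (sum_rotatedSite_mul_self h) (fun k => by
      rw [inv_mul_le_iff₀ hLd]
      exact sum_norm_expIntegral_torus_sq_le hd k hh hhL)
    (u := u * √h) (by positivity)
  rw [card_torus] at key
  have e : (u * √h) ^ 2 / (2 * Real.exp 1 * (h * (28 + 4 * Real.log L)))
      = u ^ 2 / (2 * Real.exp 1 * (28 + 4 * Real.log L)) := by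
    rw [mul_pow, Real.sq_sqrt hh.le]
    field_simp
  rwa [e] at key

/-- Union bound over the potential and the dyadic times. -/
lemma one_sub_le_measureReal_propagator (hd : 2 ≤ d) {lam M Q : ℝ} {X : ℕ} (hlam : 0 < lam)
    (hM : 0 < M) (hMQ : 10 * M ≤ Q) (hXM : 16 * X * M ^ 2 ≤ Q ^ 2)
    (hX : 4 ≤ Q ^ 2 * lam ^ 2 * 2 ^ X) (hXL : (2 : ℝ) ^ X ≤ L) :
    1 - (X + 1) * (L ^ d * Real.exp (1 - M ^ 2 / (2 * Real.exp 1 * (28 + 4 * Real.log L))))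
      ≤ (potentialLaw d L).real {V : Torus d L → ℝ | ∀ t : ℝ,
        ‖propagator (hamiltonian lam V) t - propagator (laplacian d L) t‖
          ≤ Q * lam * √|t|} := by
  have : IsProbabilityMeasure (potentialLaw d L) := by unfold potentialLaw; infer_instance
  have hL1 : (1 : ℝ) ≤ L := by exact_mod_cast Nat.pos_of_ne_zero (NeZero.ne L)
  have hlog := Real.log_nonneg hL1
  set ε : ℝ := L ^ d * Real.exp (1 - M ^ 2 / (2 * Real.exp 1 * (28 + 4 * Real.log L))) with hε
  set S : Set (Torus d L → ℝ) := {V | ∀ t : ℝ,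
    ‖propagator (hamiltonian lam V) t - propagator (laplacian d L) t‖ ≤ Q * lam * √|t|} with hS
  set B₀ : Set (Torus d L → ℝ) :=
    {V | M ≤ ‖(diagonal fun x => (V x : ℂ) : Matrix (Torus d L) (Torus d L) ℂ)‖} with hB₀
  set B : ℕ → Set (Torus d L → ℝ) := fun k =>
    {V | M * √(2 ^ k) ≤ ‖gaussianSeries (rotatedSite d L (2 ^ k)) V‖} with hB
  have hcover : Set.univ ⊆ S ∪ (B₀ ∪ ⋃ k ∈ Finset.range X, B k) := by
    intro V _
    by_contra hcon
    simp only [Set.mem_union, not_or, Set.mem_iUnion, not_exists, Finset.mem_range] at hcon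
    obtain ⟨hVS, hV0, hVB⟩ := hcon
    refine hVS fun t => norm_propagator_sub_le hlam hM.le hMQ hXM hX (not_le.1 hV0).le ?_ t
    exact fun k hk => (not_le.1 (hVB k hk)).le
  have h1 : 1 ≤ (potentialLaw d L).real S + ((potentialLaw d L).real B₀
      + ∑ k ∈ Finset.range X, (potentialLaw d L).real (B k)) := by
    calc (1 : ℝ) = (potentialLaw d L).real Set.univ := by simp
      _ ≤ (potentialLaw d L).real (S ∪ (B₀ ∪ ⋃ k ∈ Finset.range X, B k)) := measureReal_mono hcover
      _ ≤ (potentialLaw d L).real S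
          + (potentialLaw d L).real (B₀ ∪ ⋃ k ∈ Finset.range X, B k) := measureReal_union_le _ _
      _ ≤ (potentialLaw d L).real S + ((potentialLaw d L).real B₀
          + (potentialLaw d L).real (⋃ k ∈ Finset.range X, B k)) := by
          gcongr; exact measureReal_union_le _ _
      _ ≤ _ := by gcongr; exact measureReal_biUnion_finset_le _ _
  have h2 : (potentialLaw d L).real B₀ ≤ ε := by
    refine (measureReal_norm_diagonal_ge_le hM).trans ?_
    have h3 : M ^ 2 / (2 * Real.exp 1 * (28 + 4 * Real.log L)) ≤ M ^ 2 / (2 * Real.exp 1) :=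
      div_le_div_of_nonneg_left (sq_nonneg M) (by positivity)
        (le_mul_of_one_le_right (by positivity) (by linarith))
    exact mul_le_mul_of_nonneg_left (Real.exp_le_exp.2 (by linarith)) (by positivity)
  have h3 : ∑ k ∈ Finset.range X, (potentialLaw d L).real (B k) ≤ X * ε := by
    have := Finset.sum_le_card_nsmul (Finset.range X) (fun k => (potentialLaw d L).real (B k)) ε
      fun k hk => measureReal_norm_rotatedSite_ge_le hd (by positivity)
        ((pow_le_pow_right₀ one_le_two (Finset.mem_range.1 hk).le).trans hXL) hM
    rwa [Finset.card_range, nsmul_eq_mul] at this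
  linarith

end Assembly

/-- With `l = log lam⁻¹`, at most `4 l` dyadic scales and the threshold `K l² / (4 √X)`, the
failure probability in the union bound is at most `exp (-K²)`: the exponent `-K² l² / 192000`
absorbs the logarithm `O(d l)` of the number of events and sites. -/
lemma union_bound_le_exp {d L X : ℕ} {l K K₀ : ℝ} (hK₀ : 0 < K₀) (hK : K₀ ≤ K) (hl : 1000 ≤ l)
    (hl2 : (6 + 101 * d) * 384000 ≤ K₀ ^ 2 * l) (hL1 : (1 : ℝ) ≤ L)
    (hL : Real.log L ≤ 101 * l) (hX0 : 0 < X) (hX : (X : ℝ) ≤ 4 * l) :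
    (X + 1) * (L ^ d * Real.exp (1 - (K * l ^ 2 / (4 * √X)) ^ 2
      / (2 * Real.exp 1 * (28 + 4 * Real.log L)))) ≤ Real.exp (-1 * K ^ 2) := by
  have hX' : (0 : ℝ) < X := by exact_mod_cast hX0
  have hlog := Real.log_nonneg hL1
  have hK' : K₀ ^ 2 ≤ K ^ 2 := by gcongr
  have h1 : (X : ℝ) + 1 ≤ Real.exp (5 * l) := by linarith [Real.add_one_le_exp (5 * l)]
  have h2 : (L : ℝ) ^ d ≤ Real.exp (101 * d * l) := by
    calc (L : ℝ) ^ d = Real.exp (d * Real.log L) := by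
          rw [Real.exp_nat_mul, Real.exp_log (by linarith)]
      _ ≤ _ := by
          have : (d : ℝ) * Real.log L ≤ d * (101 * l) := by gcongr
          exact Real.exp_le_exp.2 (by linarith)
  have h3 : K ^ 2 * l ^ 2 / 192000
      ≤ (K * l ^ 2 / (4 * √X)) ^ 2 / (2 * Real.exp 1 * (28 + 4 * Real.log L)) := by
    have he : 2 * Real.exp 1 ≤ 6 := by linarith [Real.exp_one_lt_d9]
    have e1 : 2 * Real.exp 1 * (28 + 4 * Real.log L) ≤ 6 * (500 * l) := by
      gcongr; linarith
    have e2 : K ^ 2 * l ^ 3 / 64 ≤ (K * l ^ 2 / (4 * √X)) ^ 2 := by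
      rw [div_pow, mul_pow, mul_pow, Real.sq_sqrt hX'.le, div_le_div_iff₀ (by norm_num)
        (by positivity)]
      have : K ^ 2 * l ^ 3 * 16 * X ≤ K ^ 2 * l ^ 3 * 16 * (4 * l) := by
        have : 0 ≤ l := by linarith
        gcongr
      linarith
    calc K ^ 2 * l ^ 2 / 192000 = K ^ 2 * l ^ 3 / 64 / (6 * (500 * l)) := by
          field_simp; ring
      _ ≤ _ := by gcongr
  have h4 : 5 * l + 101 * d * l + (1 - K ^ 2 * l ^ 2 / 192000) ≤ -1 * K ^ 2 := by
    have e1 : (6 + 101 * d) * 384000 * l ≤ K ^ 2 * l * l := by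
      have : (6 + 101 * (d : ℝ)) * 384000 ≤ K ^ 2 * l := hl2.trans (by gcongr)
      gcongr
    have e2 : K ^ 2 * 384000 ≤ K ^ 2 * l ^ 2 := by
      gcongr; nlinarith
    nlinarith
  calc _ ≤ Real.exp (5 * l) * (Real.exp (101 * d * l)
        * Real.exp (1 - K ^ 2 * l ^ 2 / 192000)) := by gcongr
    _ = Real.exp (5 * l + 101 * d * l + (1 - K ^ 2 * l ^ 2 / 192000)) := by
        rw [← Real.exp_add, ← Real.exp_add]; ring_nf
    _ ≤ _ := by gcongr

end Anderson

end

theorem mainTheorem5 (d : ℕ) (hd : 2 ≤ d) :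
    ∃ c : ℝ, 0 < c ∧ ∀ K₀ : ℝ, 0 < K₀ → ∃ lam₀ : ℝ, 0 < lam₀ ∧
      ∀ lam : ℝ, 0 < lam → lam ≤ lam₀ →
      ∀ (L : ℕ) [NeZero L], L = ⌈lam⁻¹ ^ 100⌉₊ →
      ∀ K : ℝ, K₀ ≤ K →
        1 - Real.exp (-c * K ^ 2) ≤
          (Anderson.potentialLaw d L).real
            {V : Anderson.Torus d L → ℝ | ∀ t : ℝ,
              ‖Anderson.propagator (Anderson.hamiltonian lam V) t
                  - Anderson.propagator (Anderson.laplacian d L) t‖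
                ≤ K * Real.log lam⁻¹ ^ 2 * lam * Real.sqrt |t|} := by
  refine ⟨1, one_pos, fun K₀ hK₀ => ?_⟩
  -- The three summands serve the numerical constants, the bound `2 ≤ K l²` that makes the dyadic
  -- times reach all nontrivial times, and the union bound over the `L ^ d` sites.
  refine ⟨Real.exp (-(1000 + 2 / K₀ + (6 + 101 * d) * 384000 / K₀ ^ 2)), Real.exp_pos _, ?_⟩
  intro lam hlam hlam₀ L _ hL K hK
  have hl : 1000 + 2 / K₀ + (6 + 101 * d) * 384000 / K₀ ^ 2 ≤ Real.log lam⁻¹ := by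
    rw [Real.log_inv, le_neg]
    exact (Real.log_le_iff_le_exp hlam).2 hlam₀
  set l := Real.log lam⁻¹ with hldef
  have hexp : lam⁻¹ = Real.exp l := (Real.exp_log (inv_pos.2 hlam)).symm
  have hp1 : 0 ≤ 2 / K₀ := by positivity
  have hp2 : 0 ≤ (6 + 101 * d) * 384000 / K₀ ^ 2 := by positivity
  have hl1 : 1000 ≤ l := by linarith
  have hl2 : (6 + 101 * d) * 384000 ≤ K₀ ^ 2 * l := by
    have : (6 + 101 * d) * 384000 / K₀ ^ 2 ≤ l := by linarith
    rw [div_le_iff₀ (by positivity)] at this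
    linarith
  have hl3 : 2 ≤ K₀ * l ^ 2 := by
    have : 2 / K₀ ≤ l := by linarith
    rw [div_le_iff₀ hK₀] at this
    nlinarith
  have hpow : lam⁻¹ ^ 100 = Real.exp (100 * l) := by rw [hexp, ← Real.exp_nat_mul]; norm_num
  have hLlow : Real.exp (100 * l) ≤ L := by rw [hL, ← hpow]; exact Nat.le_ceil _
  have hLup : (L : ℝ) ≤ Real.exp (101 * l) := by
    have h1 : (L : ℝ) < lam⁻¹ ^ 100 + 1 := by
      rw [hL]; exact Nat.ceil_lt_add_one (by positivity)
    have h2 : (1 : ℝ) ≤ Real.exp (100 * l) := Real.one_le_exp (by linarith)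
    have h3 : (2 : ℝ) ≤ Real.exp l := by linarith [Real.add_one_le_exp l]
    have h4 : Real.exp (101 * l) = Real.exp (100 * l) * Real.exp l := by
      rw [← Real.exp_add]; ring_nf
    rw [hpow] at h1
    rw [h4]; nlinarith
  have hL1 : (1 : ℝ) ≤ L := (Real.one_le_exp (by linarith)).trans hLlow
  have hLlog : Real.log L ≤ 101 * l := (Real.log_le_iff_le_exp (by linarith)).2 hLup
  -- `X` scales reach beyond time `lam⁻²`, as `3 log 2 ≥ 2`, yet stay below time `L`.
  obtain ⟨X, hX1, hX2⟩ : ∃ X : ℕ, 3 * l ≤ X ∧ (X : ℝ) ≤ 4 * l :=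
    ⟨⌈3 * l⌉₊, Nat.le_ceil _, by linarith [Nat.ceil_lt_add_one (show 0 ≤ 3 * l by linarith)]⟩
  have hX0 : (0 : ℝ) < X := by linarith
  have hKpos : 0 < K := hK₀.trans_le hK
  have hQ2 : 2 ≤ K * l ^ 2 := hl3.trans (by gcongr)
  have hsqX : √(X : ℝ) ^ 2 = X := Real.sq_sqrt hX0.le
  have hsX : 5 / 2 ≤ √(X : ℝ) := Real.le_sqrt_of_sq_le (by linarith)
  have hM : 0 < K * l ^ 2 / (4 * √X) := by positivity
  refine le_trans ?_ (Anderson.one_sub_le_measureReal_propagator hd hlam hM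
    (Q := K * l ^ 2) (X := X) ?_ ?_ ?_ ?_)
  · linarith [Anderson.union_bound_le_exp hK₀ hK hl1 hl2 hL1 hLlog (by exact_mod_cast hX0) hX2]
  · rw [← mul_div_assoc, div_le_iff₀ (by positivity)]
    nlinarith
  · rw [div_pow, mul_pow 4, hsqX]
    refine le_of_eq ?_
    field_simp
    norm_num
  · have h2X : Real.exp (2 * l) ≤ 2 ^ X := by
      rw [← Real.exp_log (show (0 : ℝ) < 2 ^ X by positivity), Real.log_pow]
      have := Real.log_two_gt_d9
      exact Real.exp_le_exp.2 (by nlinarith)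
    have h1 : lam ^ 2 * Real.exp (2 * l) = 1 := by
      have : Real.exp (2 * l) = (lam⁻¹) ^ 2 := by
        rw [hexp, ← Real.exp_nat_mul]; norm_num
      rw [this, ← mul_pow, mul_inv_cancel₀ hlam.ne', one_pow]
    have h3 : 1 ≤ lam ^ 2 * 2 ^ X := by rw [← h1]; gcongr
    have h4 : (4 : ℝ) ≤ (K * l ^ 2) ^ 2 := by nlinarith
    calc (4 : ℝ) = 4 * 1 := by norm_num
      _ ≤ (K * l ^ 2) ^ 2 * (lam ^ 2 * 2 ^ X) := by gcongr
      _ = _ := by ring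
  · calc (2 : ℝ) ^ X ≤ Real.exp 1 ^ X := by
          gcongr; linarith [Real.exp_one_gt_d9]
      _ = Real.exp X := by rw [← Real.exp_nat_mul, mul_one]
      _ ≤ Real.exp (100 * l) := by gcongr; linarith
      _ ≤ L := hLlow
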